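/- All digraphs are finite, without loops and multiple arcs. Write $x\to y$ if $xy$ is an arc, and $x\leftrightarrow y$ if $x\to y$ and $y\to x$. Two distinct vertices are non-adjacent if there is no arc between them in either direction. The degree $d(v)$ is the sum of the out-degree and the in-degree of $v$, and for a set $X$ of vertices $d_X(v)$ denotes the number of arcs from $v$ to $X$ plus the number of arcs from $X$ to $v$. A digraph is strong if for every ordered pair $(x,y)$ of vertices it contains a directed path from $x$ to $y$, and it is hamiltonian if it has a directed cycle through all its vertices. For an odd integer $a\ge 3$ let $\mathcal H_1$ be the set of the digraphs $H$ of order $2a$ whose vertex set is a disjoint union of sets $S,R,U,W$ with $|S|=|W|=\frac{a+1}{2}$ and $|U|=|R|=\frac{a-1}{2}$ (so that $H$ is bipartite with partite sets $S\cup R$ and $U\cup W$), and whose arcs are exactly the following: (a) $r\leftrightarrow w$ for all $r\in R$, $w\in W$; (b) $u\leftrightarrow s$ for all $u\in U$, $s\in S$; (c) $w\to s$ for all $w\in W$, $s\in S$; (d) some arcs between $U$ and $R$, such that $u\to r$ for at least one pair $u\in U$, $r\in R$, and $d_U(r)\ge\frac{a-3}{2}$ for all $r\in R$, and $d_R(u)\ge\frac{a-3}{2}$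 for all $u\in U$. Let $H_2$ be the digraph with vertices $x_1,x_2,x_3,y_1,y_2,y_3$ and arcs $x_1\to y_2$, $y_2\to x_3$, $x_3\to y_3$, $y_3\to x_1$, $x_2\leftrightarrow y_2$, $x_2\leftrightarrow y_3$, $y_1\leftrightarrow x_1$, $y_1\leftrightarrow x_3$. **Theorem.** Let $D$ be a bipartite digraph with partite sets $V_1,V_2$, where $|V_1|=|V_2|=a\ge 3$. If $D$ is strong and $d(u)+d(v)\ge 3a-1$ for every pair of distinct non-adjacent vertices $u,v$, then $D$ is hamiltonian, or $D$ is isomorphic to a member of $\mathcal H_1$ of order $2a$ (with $a$ odd), or $D$ is isomorphic to $H_2$. Conversely, if $D$ is isomorphic to a member of $\mathcal H_1$ of order $2a$ or to $H_2$, then $D$ is strong, satisfies $d(u)+d(v)\ge 3a-1$ for every pair of distinct non-adjacent vertices $u,v$, and is not hamiltonian. -/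

import Mathlib

namespace Digraph

/-- A digraph is strong if every vertex can be reached from every vertex along arcs. -/
def IsStrong {V : Type*} (D : Digraph V) : Prop :=
  ∀ x y : V, Relation.ReflTransGen D.Adj x y

/-- A hamiltonian cycle: a cyclic enumeration `c 0, c 1, …, c (n - 1)` of all the vertices, without
repetition, in which every vertex dominates the next one and `c (n - 1)` dominates `c 0`. -/
def IsHamiltonian {V : Type*} (D : Digraph V) : Prop :=
  ∃ n : ℕ, 2 ≤ n ∧ ∃ c : ZMod n → V, Function.Bijective c ∧ ∀ i, D.Adj (c i) (c (i + 1))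

/-- `D` is bipartite with partite sets `V₁` and `V₂`, each of them having `a` elements.
In particular `D` has order `2 * a` and no loops. -/
structure IsBalancedBipartite {V : Type*} (D : Digraph V) (a : ℕ) (V₁ V₂ : Finset V) : Prop where
  disjoint : Disjoint V₁ V₂
  cover : ∀ v, v ∈ V₁ ∨ v ∈ V₂
  card_left : V₁.card = a
  card_right : V₂.card = a
  indep_left : ∀ x ∈ V₁, ∀ y ∈ V₁, ¬ D.Adj x y
  indep_right : ∀ x ∈ V₂, ∀ y ∈ V₂, ¬ D.Adj x y

open Classical in
/-- The number of arcs from `v` to `X` plus the number of arcs from `X` to `v`. -/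
noncomputable def degreeIn {V : Type*} (D : Digraph V) (X : Finset V) (v : V) : ℕ :=
  (X.filter fun u => D.Adj v u).card + (X.filter fun u => D.Adj u v).card

/-- The degree `d(v) = d⁺(v) + d⁻(v)`. -/
noncomputable def degree {V : Type*} [Fintype V] (D : Digraph V) (v : V) : ℕ :=
  D.degreeIn Finset.univ v

/-- The condition `M_k`, for a digraph of order `2 * a`: `d(u) + d(v) ≥ 3a + k` for every two
distinct vertices `u`, `v` that are not joined by an arc in either direction. -/
def ConditionM {V : Type*} [Fintype V] (D : Digraph V) (a : ℕ) (k : ℤ) : Prop :=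
  ∀ u v : V, u ≠ v → ¬ D.Adj u v → ¬ D.Adj v u →
    3 * (a : ℤ) + k ≤ (D.degree u : ℤ) + (D.degree v : ℤ)

/-- `H` is a member of the family `𝓗₁` of digraphs of order `2 * a`, where the partite sets are
`S ∪ R` and `U ∪ W`. The divisions are exact, since `a` is odd and `a ≥ 3`. -/
structure IsH1With {V : Type*} (H : Digraph V) (a : ℕ) (S R U W : Finset V) : Prop where
  odd : Odd a
  three_le : 3 ≤ a
  disjoint_SR : Disjoint S R
  disjoint_SU : Disjoint S U
  disjoint_SW : Disjoint S W
  disjoint_RU : Disjoint R U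
  disjoint_RW : Disjoint R W
  disjoint_UW : Disjoint U W
  cover : ∀ v, v ∈ S ∨ v ∈ R ∨ v ∈ U ∨ v ∈ W
  card_S : S.card = (a + 1) / 2
  card_W : W.card = (a + 1) / 2
  card_U : U.card = (a - 1) / 2
  card_R : R.card = (a - 1) / 2
  arcs_RW : ∀ r ∈ R, ∀ w ∈ W, H.Adj r w ∧ H.Adj w r
  arcs_US : ∀ u ∈ U, ∀ s ∈ S, H.Adj u s ∧ H.Adj s u
  arcs_WS : ∀ w ∈ W, ∀ s ∈ S, H.Adj w s
  arc_UR : ∃ r ∈ R, ∃ u ∈ U, H.Adj u r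
  degree_R : ∀ r ∈ R, (a - 3) / 2 ≤ H.degreeIn U r
  degree_U : ∀ u ∈ U, (a - 3) / 2 ≤ H.degreeIn R u
  /-- There are no other arcs; those between `U` and `R` are restricted only by the three
  preceding conditions. -/
  arcs_only : ∀ x y, H.Adj x y →
    (x ∈ R ∧ y ∈ W) ∨ (x ∈ W ∧ y ∈ R) ∨ (x ∈ U ∧ y ∈ S) ∨ (x ∈ S ∧ y ∈ U) ∨
      (x ∈ W ∧ y ∈ S) ∨ (x ∈ U ∧ y ∈ R) ∨ (x ∈ R ∧ y ∈ U)

/-- The members of the family `𝓗₁` of order `2 * a` with vertex set `V`. -/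
def familyH1 (V : Type*) (a : ℕ) : Set (Digraph V) :=
  {H | ∃ S R U W : Finset V, H.IsH1With a S R U W}

/-- The digraph `H₂`; here `Sum.inl 0, Sum.inl 1, Sum.inl 2` are `x₁, x₂, x₃` and
`Sum.inr 0, Sum.inr 1, Sum.inr 2` are `y₁, y₂, y₃`. -/
def digraphH2 : Digraph (Fin 3 ⊕ Fin 3) where
  Adj p q := (p, q) ∈ ([
    (Sum.inl 0, Sum.inr 1), (Sum.inr 1, Sum.inl 2), (Sum.inl 2, Sum.inr 2), (Sum.inr 2, Sum.inl 0),
    (Sum.inl 1, Sum.inr 1), (Sum.inr 1, Sum.inl 1), (Sum.inl 1, Sum.inr 2), (Sum.inr 2, Sum.inl 1),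
    (Sum.inr 0, Sum.inl 0), (Sum.inl 0, Sum.inr 0), (Sum.inr 0, Sum.inl 2), (Sum.inl 2, Sum.inr 0)
    ] : List ((Fin 3 ⊕ Fin 3) × (Fin 3 ⊕ Fin 3)))

/-- Two digraphs are isomorphic. -/
def IsIsomorphic {V W : Type*} (D : Digraph V) (H : Digraph W) : Prop :=
  Nonempty (D.Adj ≃r H.Adj)

end Digraph

/-!
The proof is elementary. A cycle factor is encoded by its successor permutation `σ`, so that a
hamiltonian cycle is a cycle factor with a single cycle.

If there is no cycle factor, Hall's theorem gives a set `S` on one side with fewer than `S.card`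
out-neighbours. Then the vertices of `S` have few out-neighbours, and the vertices of the other side
which are not dominated by `S` have few in-neighbours; the degree condition is so tight here that it
determines the digraph up to the arcs between `U` and `R`: it lies in `familyH1`
(`exists_isCycleFactor_or_mem_familyH1`).

If there is a cycle factor, the basic operation is to exchange the successors of two vertices `x`,
`y` on different cycles, which merges these cycles. In a factor that admits no merging, at most one
of the arcs `x → σ y`, `y → σ x` is present, so at most half of the possible arcs between two cycles
are (`arcs_compl_le`). With the degree condition this leaves, for `a ≥ 4`, exactly two cycles,
either of them of about half the order or one of them a 2-cycle; moreover, one of the cycles spans a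
complete bipartite digraph on its vertex set `K`. The vertices of `K` can then be exchanged freely,
so a vertex outside `K` which dominates a vertex of `K` has a successor which is not dominated by
`K` (`not_adj_and_adj`). If `K` has at least four vertices, strong connectivity yields a vertex not
joined to `K`, whose degree is too small (`false_of_complete`). If `K` is a 2-cycle, then a
vertex-insertion argument (`not_adj_of_two_cycle`) and a count of the arcs at the 2-cycle
(`false_of_two_cycle`) give a contradiction.

For `a = 3` the digraph is given by two 3 × 3 matrices with six entries fixed by the cycle factor,
and the remaining possibilities are checked by evaluation; only `digraphH2` survives.

Conversely, in a member of `familyH1` the larger set `S` has all its out-neighbours in `U`, and for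
`digraphH2` the absence of a hamiltonian cycle is a finite check.
-/

namespace Digraph

open Equiv Equiv.Perm

/-! ### Cycle factors and the merging of cycles -/

/-- A cycle factor, encoded by its successor permutation: the cycles of `σ` are vertex-disjoint
directed cycles of `D` that cover all the vertices. -/
def IsCycleFactor {V : Type*} (D : Digraph V) (σ : Perm V) : Prop :=
  ∀ v, D.Adj v (σ v)

/-- Exchanging the successors of two vertices on different cycles merges these two cycles. -/
theorem sameCycle_mul_swap_self {V : Type*} [Finite V] [DecidableEq V] {σ : Perm V} {x y : V}
    (h : ¬ σ.SameCycle x y) : (σ * swap x y).SameCycle x y := by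
  have key : ∀ j : ℕ, (∀ l, 1 ≤ l → l ≤ j → (σ ^ l) y ≠ y) →
      (σ * swap x y).SameCycle x ((σ ^ (j + 1)) y) := by
    intro j
    induction j with
    | zero =>
      intro _
      refine ⟨1, ?_⟩
      simp
    | succ j ih =>
      intro hl
      have h1 := ih fun l h1 h2 => hl l h1 (by omega)
      refine h1.trans ⟨1, ?_⟩
      have h2 : (σ ^ (j + 1)) y ≠ y := hl _ (by omega) le_rfl
      have h3 : (σ ^ (j + 1)) y ≠ x := fun h3 =>
        h (SameCycle.symm ⟨((j + 1 : ℕ) : ℤ), by rw [zpow_natCast]; exact h3⟩)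
      rw [zpow_one, Perm.mul_apply, swap_apply_of_ne_of_ne h3 h2, pow_succ' σ (j + 1),
        Perm.mul_apply]
  have hex : ∃ i, 1 ≤ i ∧ (σ ^ i) y = y :=
    ⟨orderOf σ, orderOf_pos σ, by simp [pow_orderOf_eq_one]⟩
  classical
  obtain ⟨h1, h2⟩ := Nat.find_spec hex
  have h3 := key (Nat.find hex - 1) fun l hl1 hl2 hl3 =>
    Nat.find_min hex (m := l) (by omega) ⟨hl1, hl3⟩
  rwa [Nat.sub_add_cancel h1, h2] at h3

/-- If every vertex lies on the same cycle of `τ` as its `σ`-successor, then every cycle of `σ` is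
contained in a cycle of `τ`. -/
theorem SameCycle.of_forall_apply {V : Type*} [Finite V] {σ τ : Perm V}
    (h : ∀ v, τ.SameCycle v (σ v)) {u v : V} (huv : σ.SameCycle u v) : τ.SameCycle u v := by
  obtain ⟨i, rfl⟩ := huv.exists_nat_pow_eq
  clear huv
  induction i with
  | zero => exact SameCycle.refl _ _
  | succ i ih =>
    rw [pow_succ', Perm.mul_apply]
    exact ih.trans (h _)

theorem sameCycle_mul_swap {V : Type*} [Finite V] [DecidableEq V] {σ : Perm V} {x y : V}
    (h : ¬ σ.SameCycle x y) {u v : V} (huv : σ.SameCycle u v) :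
    (σ * swap x y).SameCycle u v := by
  have hxy := sameCycle_mul_swap_self h
  refine SameCycle.of_forall_apply (fun w => ?_) huv
  rcases eq_or_ne w x with rfl | hx
  · exact hxy.trans ⟨1, by simp⟩
  rcases eq_or_ne w y with rfl | hy
  · exact hxy.symm.trans ⟨1, by simp⟩
  exact ⟨1, by simp [swap_apply_of_ne_of_ne hx hy]⟩

theorem IsCycleFactor.mul_swap {V : Type*} [DecidableEq V] {D : Digraph V} {σ : Perm V} {x y : V}
    (hσ : ∀ v, v ≠ x → v ≠ y → D.Adj v (σ v)) (hx : D.Adj x (σ y)) (hy : D.Adj y (σ x)) :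
    D.IsCycleFactor (σ * swap x y) := by
  intro v
  rcases eq_or_ne v x with rfl | h1
  · simpa using hx
  rcases eq_or_ne v y with rfl | h2
  · simpa using hy
  simpa [swap_apply_of_ne_of_ne h1 h2] using hσ v h1 h2

/-- A cycle factor consisting of a single cycle is a hamiltonian cycle. -/
theorem IsCycleFactor.isHamiltonian {V : Type*} [Fintype V] {D : Digraph V} {σ : Perm V}
    (hσ : D.IsCycleFactor σ) (hcard : 2 ≤ Fintype.card V) (h : ∀ u v, σ.SameCycle u v) :
    D.IsHamiltonian := by
  classical
  have : Nontrivial V := Fintype.one_lt_card_iff_nontrivial.mp (by omega)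
  have hfix : ∀ v, σ v ≠ v := by
    intro v hv
    obtain ⟨w, hw⟩ := exists_ne v
    obtain ⟨i, hi⟩ := (h v w).exists_nat_pow_eq
    rw [Perm.pow_apply_eq_self_of_apply_eq_self hv] at hi
    exact hw hi.symm
  obtain ⟨v₀⟩ : Nonempty V := inferInstance
  have hcyc : σ.IsCycle := ⟨v₀, hfix v₀, fun y _ => h v₀ y⟩
  have hord : orderOf σ = Fintype.card V := by
    rw [hcyc.orderOf, ← Finset.card_univ]
    congr 1
    ext v
    simp [hfix v]
  have : NeZero (Fintype.card V) := ⟨by omega⟩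
  have hmod : ∀ m, σ ^ (m % Fintype.card V) = σ ^ m := fun m => by rw [← hord, pow_mod_orderOf]
  refine ⟨Fintype.card V, hcard, fun i => (σ ^ i.val) v₀, ?_, fun i => ?_⟩
  · rw [Fintype.bijective_iff_surjective_and_card, ZMod.card]
    refine ⟨fun v => ?_, rfl⟩
    obtain ⟨i, hi, hiv⟩ := (h v₀ v).exists_pow_eq'
    exact ⟨(i : ZMod (Fintype.card V)), by
      simp only [ZMod.val_natCast, hmod, hiv]⟩
  · have h1 : (σ ^ (i + 1).val) = σ * σ ^ i.val := by
      have : ((i + 1 : ZMod (Fintype.card V))) = ((i.val + 1 : ℕ) : ZMod (Fintype.card V)) := by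
        simp
      rw [this, ZMod.val_natCast, hmod, pow_succ']
    simp only [h1, Perm.mul_apply]
    exact hσ _

/-- A cycle factor whose cycles cannot be merged any further: as many pairs of vertices as possible
lie on a common cycle. -/
def IsMaxCycleFactor {V : Type*} (D : Digraph V) (σ : Perm V) : Prop :=
  D.IsCycleFactor σ ∧ ∀ τ, D.IsCycleFactor τ →
    {p : V × V | τ.SameCycle p.1 p.2}.ncard ≤ {p : V × V | σ.SameCycle p.1 p.2}.ncard

theorem IsCycleFactor.exists_isMaxCycleFactor {V : Type*} [Finite V] {D : Digraph V} {σ : Perm V}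
    (hσ : D.IsCycleFactor σ) : ∃ τ, D.IsMaxCycleFactor τ := by
  obtain ⟨τ, h1, h2⟩ := Set.exists_max_image {τ | D.IsCycleFactor τ}
    (fun τ => {p : V × V | τ.SameCycle p.1 p.2}.ncard) (Set.toFinite _) ⟨σ, hσ⟩
  exact ⟨τ, h1, h2⟩

theorem IsMaxCycleFactor.not_adj {V : Type*} [Finite V] {D : Digraph V} {σ : Perm V}
    (hσ : D.IsMaxCycleFactor σ) {x y : V} (h : ¬ σ.SameCycle x y) :
    ¬ (D.Adj x (σ y) ∧ D.Adj y (σ x)) := by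
  classical
  rintro ⟨hx, hy⟩
  have h1 := hσ.2 _ (IsCycleFactor.mul_swap (fun v _ _ => hσ.1 v) hx hy)
  have h2 : {p : V × V | σ.SameCycle p.1 p.2} ⊂
      {p : V × V | (σ * swap x y).SameCycle p.1 p.2} := by
    refine ⟨fun p hp => sameCycle_mul_swap h hp, fun h3 => h ?_⟩
    exact h3 (show (x, y) ∈ {p : V × V | (σ * swap x y).SameCycle p.1 p.2} from
      sameCycle_mul_swap_self h)
  exact absurd (Set.ncard_lt_ncard h2 (Set.toFinite _)) (by omega)

/-- Conjugation does not change the numbers of pairs on a common cycle. -/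
theorem IsMaxCycleFactor.conj {V : Type*} [Finite V] {D : Digraph V} {σ : Perm V}
    (hσ : D.IsMaxCycleFactor σ) (π : Perm V) (h : D.IsCycleFactor (π * σ * π⁻¹)) :
    D.IsMaxCycleFactor (π * σ * π⁻¹) := by
  refine ⟨h, fun τ hτ => (hσ.2 τ hτ).trans_eq ?_⟩
  rw [← Set.ncard_image_of_injective _ (π.prodCongr π).injective]
  congr 1
  ext ⟨u, v⟩
  simp only [Set.mem_image, Set.mem_ofPred_eq, sameCycle_conj]
  constructor
  · rintro ⟨⟨a, b⟩, h1, h2⟩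
    obtain ⟨rfl, rfl⟩ := Prod.mk.inj h2
    simpa using h1
  · intro h1
    exact ⟨(π⁻¹ u, π⁻¹ v), h1, by simp⟩

/-! ### Counting arcs -/

open Classical in
/-- The indicator of the arc `u → v`. -/
noncomputable def arc {V : Type*} (D : Digraph V) (u v : V) : ℤ :=
  if D.Adj u v then 1 else 0

/-- The number of arcs from `P` to `Q`. -/
noncomputable def arcs {V : Type*} (D : Digraph V) (P Q : Finset V) : ℤ :=
  ∑ u ∈ P, ∑ v ∈ Q, D.arc u v

theorem arc_nonneg {V : Type*} (D : Digraph V) (u v : V) : 0 ≤ D.arc u v := by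
  unfold arc; split_ifs <;> simp

theorem arc_le_one {V : Type*} (D : Digraph V) (u v : V) : D.arc u v ≤ 1 := by
  unfold arc; split_ifs <;> simp

theorem arc_of_not_adj {V : Type*} {D : Digraph V} {u v : V} (h : ¬ D.Adj u v) :
    D.arc u v = 0 := by
  simp [arc, h]

theorem arc_eq_one_iff {V : Type*} {D : Digraph V} {u v : V} : D.arc u v = 1 ↔ D.Adj u v := by
  unfold arc; split_ifs <;> simp_all

theorem arc_add_arc_le_one {V : Type*} {D : Digraph V} {u v s t : V}
    (h : ¬ (D.Adj u v ∧ D.Adj s t)) : D.arc u v + D.arc s t ≤ 1 := by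
  unfold arc
  split_ifs <;> simp_all

theorem degreeIn_eq_sum {V : Type*} (D : Digraph V) (X : Finset V) (v : V) :
    (D.degreeIn X v : ℤ) = ∑ u ∈ X, (D.arc v u + D.arc u v) := by
  classical
  simp only [degreeIn, arc, Finset.sum_add_distrib, Finset.sum_boole, Nat.cast_add]

theorem degree_eq_sum {V : Type*} [Fintype V] (D : Digraph V) (v : V) :
    (D.degree v : ℤ) = ∑ u, (D.arc v u + D.arc u v) :=
  D.degreeIn_eq_sum _ v

theorem arcs_le {V : Type*} (D : Digraph V) (P Q : Finset V) :
    D.arcs P Q ≤ P.card * Q.card := by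
  calc D.arcs P Q ≤ ∑ u ∈ P, ∑ v ∈ Q, (1 : ℤ) :=
        Finset.sum_le_sum fun _ _ => Finset.sum_le_sum fun _ _ => D.arc_le_one _ _
    _ = P.card * Q.card := by simp

/-- If all possible arcs from `P` to `Q` are counted, then all of them are present. -/
theorem adj_of_card_mul_card_le_arcs {V : Type*} {D : Digraph V} {P Q : Finset V}
    (h : (P.card * Q.card : ℤ) ≤ D.arcs P Q) {u v : V} (hu : u ∈ P) (hv : v ∈ Q) :
    D.Adj u v := by
  classical
  by_contra huv
  have h1 : D.arcs P Q < ∑ u ∈ P, ∑ v ∈ Q, (1 : ℤ) := by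
    refine Finset.sum_lt_sum (fun _ _ => Finset.sum_le_sum fun _ _ => D.arc_le_one _ _) ⟨u, hu, ?_⟩
    exact Finset.sum_lt_sum (fun _ _ => D.arc_le_one _ _) ⟨v, hv, by simp [arc_of_not_adj huv]⟩
  simp at h1
  omega

/-- The bipartition of a balanced bipartite digraph with its two sides indexed by `Bool`, so that
arguments which are symmetric in the sides need to be given only once. -/
structure IsBipartition {V : Type*} (D : Digraph V) (a : ℕ) (X : Bool → Finset V) : Prop where
  cover : ∀ b v, v ∈ X b ∨ v ∈ X (!b)
  disj : ∀ b v, v ∈ X b → v ∉ X (!b)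
  card : ∀ b, (X b).card = a
  adj : ∀ b u v, D.Adj u v → u ∈ X b → v ∈ X (!b)

theorem IsBalancedBipartite.isBipartition {V : Type*} {D : Digraph V} {a : ℕ} {V₁ V₂ : Finset V}
    (h : D.IsBalancedBipartite a V₁ V₂) : D.IsBipartition a (fun b => bif b then V₁ else V₂) where
  cover b v := by cases b <;> simpa [or_comm] using h.cover v
  disj b v := by
    cases b
    · simpa using fun h1 h2 => Finset.disjoint_left.mp h.disjoint h2 h1
    · simpa using fun h1 h2 => Finset.disjoint_left.mp h.disjoint h1 h2
  card b := by cases b <;> simp [h.card_left, h.card_right]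
  adj b u v := by
    intro huv hu
    cases b
    · simpa using (h.cover v).resolve_right fun hv => h.indep_right u hu v hv huv
    · simpa using (h.cover v).resolve_left fun hv => h.indep_left u hu v hv huv

namespace IsBipartition

variable {V : Type*} [Fintype V] [DecidableEq V] {D : Digraph V} {a : ℕ} {X : Bool → Finset V}

omit [Fintype V] [DecidableEq V] in
theorem adj' (hX : D.IsBipartition a X) {b : Bool} {u v : V} (h : D.Adj u v) (hv : v ∈ X b) :
    u ∈ X (!b) := by
  refine (hX.cover b u).resolve_left fun hu => ?_
  exact hX.disj _ _ hv (hX.adj _ _ _ h hu)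

omit [Fintype V] [DecidableEq V] in
theorem not_adj (hX : D.IsBipartition a X) {b : Bool} {u v : V} (hu : u ∈ X b) (hv : v ∈ X b) :
    ¬ D.Adj u v := fun h => hX.disj _ _ hv (hX.adj _ _ _ h hu)

omit [DecidableEq V] in
theorem card_eq (hX : D.IsBipartition a X) : Fintype.card V = 2 * a := by
  classical
  rw [← Finset.card_univ, ← hX.card true]
  have : (Finset.univ : Finset V) = X true ∪ X false := by
    ext v; simpa using hX.cover true v
  rw [this, Finset.card_union_of_disjoint, hX.card, hX.card]
  · omega
  · exact Finset.disjoint_left.mpr fun v => hX.disj true v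

omit [DecidableEq V] in
theorem degree_eq (hX : D.IsBipartition a X) {b : Bool} {v : V} (hv : v ∈ X b) :
    (D.degree v : ℤ) = ∑ u ∈ X (!b), (D.arc v u + D.arc u v) := by
  rw [degree_eq_sum]
  refine (Finset.sum_subset (Finset.subset_univ _) fun u _ hu => ?_).symm
  have hu' := (hX.cover b u).resolve_right hu
  rw [arc_of_not_adj (hX.not_adj hv hu'), arc_of_not_adj (hX.not_adj hu' hv), add_zero]

theorem degree_eq_add (hX : D.IsBipartition a X) (K : Finset V) {b : Bool} {v : V}
    (hv : v ∈ X b) :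
    (D.degree v : ℤ) = ∑ u ∈ K ∩ X (!b), (D.arc v u + D.arc u v) +
      ∑ u ∈ Kᶜ ∩ X (!b), (D.arc v u + D.arc u v) := by
  rw [hX.degree_eq hv, ← Finset.sum_union]
  · congr 1
    ext u
    by_cases hu : u ∈ K <;> simp [hu]
  · exact Finset.disjoint_left.mpr fun u => by simp +contextual

theorem sum_degree (hX : D.IsBipartition a X) (K : Finset V) {b : Bool} {P : Finset V}
    (hP : P ⊆ X b) :
    ∑ v ∈ P, (D.degree v : ℤ) = D.arcs P (K ∩ X (!b)) + D.arcs (K ∩ X (!b)) P +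
      D.arcs P (Kᶜ ∩ X (!b)) + D.arcs (Kᶜ ∩ X (!b)) P := by
  rw [Finset.sum_congr rfl fun v hv => hX.degree_eq_add K (hP hv)]
  simp only [arcs, Finset.sum_add_distrib]
  rw [Finset.sum_comm (s := K ∩ X (!b)), Finset.sum_comm (s := Kᶜ ∩ X (!b))]
  ring

omit [Fintype V] in
theorem image_inter (hX : D.IsBipartition a X) {σ : Perm V} (hσ : D.IsCycleFactor σ)
    {K : Finset V} (hK : ∀ v, σ v ∈ K ↔ v ∈ K) (b : Bool) :
    (K ∩ X b).map σ.toEmbedding = K ∩ X (!b) := by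
  ext v
  obtain ⟨w, rfl⟩ := σ.surjective v
  simp only [Finset.mem_map_equiv, symm_apply_apply, Finset.mem_inter, hK]
  refine and_congr_right fun _ => ⟨hX.adj _ _ _ (hσ w), fun h => ?_⟩
  simpa using hX.adj' (hσ w) h

omit [Fintype V] in
theorem card_inter_not (hX : D.IsBipartition a X) {σ : Perm V} (hσ : D.IsCycleFactor σ)
    {K : Finset V} (hK : ∀ v, σ v ∈ K ↔ v ∈ K) (b : Bool) :
    (K ∩ X (!b)).card = (K ∩ X b).card := by
  rw [← hX.image_inter hσ hK b, Finset.card_map]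

omit [Fintype V] in
theorem sum_inter_not (hX : D.IsBipartition a X) {σ : Perm V} (hσ : D.IsCycleFactor σ)
    {K : Finset V} (hK : ∀ v, σ v ∈ K ↔ v ∈ K) (b : Bool) (f : V → ℤ) :
    ∑ v ∈ K ∩ X (!b), f v = ∑ v ∈ K ∩ X b, f (σ v) := by
  rw [← hX.image_inter hσ hK b, Finset.sum_map]
  rfl

theorem card_add_card_compl (hX : D.IsBipartition a X) (K : Finset V) (b : Bool) :
    (K ∩ X b).card + (Kᶜ ∩ X b).card = a := by
  rw [← hX.card b, ← Finset.card_union_of_disjoint]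
  · congr 1
    ext u
    by_cases hu : u ∈ K <;> simp [hu]
  · exact Finset.disjoint_left.mpr fun u => by simp +contextual

/-- Since no two cycles can be merged, of the two arcs `x → σ y` and `y → σ x` at most one is
present if `x` and `y` lie on different cycles. Summing over all such pairs bounds the number of
arcs between a union `K` of cycles and its complement. -/
theorem arcs_compl_le (hX : D.IsBipartition a X) {σ : Perm V} (hσ : D.IsMaxCycleFactor σ)
    {K : Finset V} (hK : ∀ u v, σ.SameCycle u v → (u ∈ K ↔ v ∈ K)) (b : Bool) :
    D.arcs (K ∩ X b) (Kᶜ ∩ X (!b)) + D.arcs (Kᶜ ∩ X b) (K ∩ X (!b)) ≤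
      (K ∩ X b).card * (Kᶜ ∩ X b).card := by
  have hK1 : ∀ v, σ v ∈ K ↔ v ∈ K := fun v => hK _ _ (by simp [SameCycle.refl])
  have hK2 : ∀ v, σ v ∈ Kᶜ ↔ v ∈ Kᶜ := fun v => by simp [hK1]
  simp only [arcs]
  rw [Finset.sum_comm (s := Kᶜ ∩ X b)]
  simp only [hX.sum_inter_not hσ.1 hK2, hX.sum_inter_not hσ.1 hK1]
  rw [← Finset.sum_add_distrib]
  simp only [← Finset.sum_add_distrib]
  calc _ ≤ ∑ x ∈ K ∩ X b, ∑ y ∈ Kᶜ ∩ X b, (1 : ℤ) := by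
        refine Finset.sum_le_sum fun x hx => Finset.sum_le_sum fun y hy => ?_
        simp only [Finset.mem_inter, Finset.mem_compl] at hx hy
        exact arc_add_arc_le_one
          (hσ.not_adj (x := x) (y := y) fun h => hy.1 ((hK _ _ h).1 hx.1))
    _ = _ := by simp

end IsBipartition

/-- If any two values of `f` on `P` add up to at least `s`, then the average of `f` is at least
`s / 2`. -/
theorem card_mul_le_two_mul_sum {ι : Type*} {P : Finset ι} {f : ι → ℤ} {s : ℤ}
    (hP : 2 ≤ P.card) (h : ∀ u ∈ P, ∀ v ∈ P, u ≠ v → s ≤ f u + f v) :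
    P.card * s ≤ 2 * ∑ v ∈ P, f v := by
  classical
  obtain ⟨w, hw, hmin⟩ := P.exists_min_image f (Finset.card_pos.mp (by omega))
  have hc : ((P.erase w).card : ℤ) = P.card - 1 := by
    rw [Finset.card_erase_of_mem hw]; omega
  have h1 : ((P.erase w).card : ℤ) * max (f w) (s - f w) ≤ ∑ v ∈ P.erase w, f v := by
    rw [← nsmul_eq_mul]
    refine Finset.card_nsmul_le_sum _ _ _ fun v hv => ?_
    obtain ⟨hvw, hv⟩ := Finset.mem_erase.mp hv
    have := hmin v hv
    have := h v hv w hw hvw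
    omega
  rw [← Finset.add_sum_erase P f hw]
  have h2 : (2 : ℤ) ≤ P.card := by exact_mod_cast hP
  rw [hc] at h1
  rcases le_total (f w) (s - f w) with h3 | h3
  · rw [max_eq_right h3] at h1
    nlinarith [mul_nonneg (sub_nonneg.mpr h2) (sub_nonneg.mpr h3)]
  · rw [max_eq_left h3] at h1
    nlinarith

/-- If any two values of `f` on `P` add up to at least the odd number `2 * t - 1`, then at most one
value is smaller than `t`, so the sum misses `t * P.card` by at most one. -/
theorem card_mul_sub_one_le_sum {ι : Type*} {P : Finset ι} {f : ι → ℤ} {t : ℤ}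
    (hP : 2 ≤ P.card) (h : ∀ u ∈ P, ∀ v ∈ P, u ≠ v → 2 * t - 1 ≤ f u + f v) :
    P.card * t - 1 ≤ ∑ v ∈ P, f v := by
  classical
  obtain ⟨w, hw, hmin⟩ := P.exists_min_image f (Finset.card_pos.mp (by omega))
  have hc : ((P.erase w).card : ℤ) = P.card - 1 := by
    rw [Finset.card_erase_of_mem hw]; omega
  have h1 : ((P.erase w).card : ℤ) * max (f w) (2 * t - 1 - f w) ≤ ∑ v ∈ P.erase w, f v := by
    rw [← nsmul_eq_mul]
    refine Finset.card_nsmul_le_sum _ _ _ fun v hv => ?_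
    obtain ⟨hvw, hv⟩ := Finset.mem_erase.mp hv
    have := hmin v hv
    have := h v hv w hw hvw
    omega
  rw [← Finset.add_sum_erase P f hw]
  have h2 : (2 : ℤ) ≤ P.card := by exact_mod_cast hP
  rw [hc] at h1
  rcases le_or_gt t (f w) with h3 | h3
  · have := le_max_left (f w) (2 * t - 1 - f w)
    nlinarith
  · have := le_max_right (f w) (2 * t - 1 - f w)
    have h4 : 0 ≤ (t - 1 - f w) := by omega
    nlinarith [mul_nonneg (sub_nonneg.mpr h2) h4]

/-! ### The number and the lengths of the cycles -/

theorem SameCycle.induction {V : Type*} [Finite V] {σ : Perm V} {Q : V → Prop}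
    (h : ∀ z, Q z → Q (σ z)) {u v : V} (huv : σ.SameCycle u v) (hu : Q u) : Q v := by
  obtain ⟨i, rfl⟩ := huv.exists_nat_pow_eq
  clear huv
  induction i with
  | zero => exact hu
  | succ i ih =>
    rw [pow_succ', Perm.mul_apply]
    exact h _ ih

theorem IsStrong.exists_adj {V : Type*} {D : Digraph V} (hD : D.IsStrong) {Q : V → Prop}
    {x y : V} (hx : Q x) (hy : ¬ Q y) : ∃ u v, Q u ∧ ¬ Q v ∧ D.Adj u v := by
  by_contra! h
  have key : ∀ z, Relation.ReflTransGen D.Adj x z → Q z := by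
    intro z hz
    induction hz with
    | refl => exact hx
    | tail _ h1 ih => exact by_contra fun h2 => h _ _ ih h2 h1
  exact hy (key y (hD x y))

/-- The vertex set of the cycle of `σ` through `x`. -/
def cycleSet {V : Type*} [Fintype V] [DecidableEq V] (σ : Perm V) (x : V) : Finset V :=
  Finset.univ.filter fun v => σ.SameCycle x v

theorem mem_cycleSet {V : Type*} [Fintype V] [DecidableEq V] {σ : Perm V} {x v : V} :
    v ∈ cycleSet σ x ↔ σ.SameCycle x v := by
  simp [cycleSet]

theorem cycleSet_iff {V : Type*} [Fintype V] [DecidableEq V] {σ : Perm V} (x : V) {u v : V}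
    (h : σ.SameCycle u v) : u ∈ cycleSet σ x ↔ v ∈ cycleSet σ x := by
  rw [mem_cycleSet, mem_cycleSet]
  exact ⟨fun h1 => h1.trans h, fun h1 => h1.trans h.symm⟩

/-- The degree condition for pairs of vertices on the same side, the only pairs needed for orders
larger than six. -/
def SideCondition {V : Type*} [Fintype V] (D : Digraph V) (a : ℕ) (X : Bool → Finset V) : Prop :=
  ∀ b, ∀ u ∈ X b, ∀ v ∈ X b, u ≠ v → 3 * (a : ℤ) - 1 ≤ (D.degree u : ℤ) + D.degree v

namespace IsBipartition

variable {V : Type*} [Fintype V] [DecidableEq V] {D : Digraph V} {a : ℕ} {X : Bool → Finset V}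

omit [DecidableEq V] in
theorem sideCondition (hX : D.IsBipartition a X) (hM : D.ConditionM a (-1)) :
    D.SideCondition a X := fun _ u hu v hv huv =>
  hM u v huv (hX.not_adj hu hv) (hX.not_adj hv hu)

theorem sum_degree_add_le (hX : D.IsBipartition a X) {σ : Perm V} (hσ : D.IsMaxCycleFactor σ)
    {K : Finset V} (hK : ∀ u v, σ.SameCycle u v → (u ∈ K ↔ v ∈ K)) (b : Bool) :
    ∑ v ∈ K ∩ X b, (D.degree v : ℤ) + ∑ v ∈ K ∩ X (!b), (D.degree v : ℤ) ≤
      2 * (D.arcs (K ∩ X b) (K ∩ X (!b)) + D.arcs (K ∩ X (!b)) (K ∩ X b)) +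
        2 * ((K ∩ X b).card * (Kᶜ ∩ X b).card) := by
  have hK1 : ∀ v, σ v ∈ K ↔ v ∈ K := fun v => hK _ _ (by simp [SameCycle.refl])
  have hK2 : ∀ v, σ v ∈ Kᶜ ↔ v ∈ Kᶜ := fun v => by simp [hK1]
  have h1 := hX.arcs_compl_le hσ hK b
  have h2 := hX.arcs_compl_le hσ hK (!b)
  rw [hX.card_inter_not hσ.1 hK1, hX.card_inter_not hσ.1 hK2] at h2
  have h3 := hX.sum_degree K (b := b) (P := K ∩ X b) Finset.inter_subset_right
  have h4 := hX.sum_degree K (b := !b) (P := K ∩ X (!b)) Finset.inter_subset_right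
  simp only [Bool.not_not] at h2 h4
  rw [h3, h4]
  linarith

theorem sum_degree_add_le' (hX : D.IsBipartition a X) {σ : Perm V} (hσ : D.IsMaxCycleFactor σ)
    {K : Finset V} (hK : ∀ u v, σ.SameCycle u v → (u ∈ K ↔ v ∈ K)) (b : Bool) :
    ∑ v ∈ K ∩ X b, (D.degree v : ℤ) + ∑ v ∈ K ∩ X (!b), (D.degree v : ℤ) ≤
      2 * (K ∩ X b).card * ((K ∩ X b).card + a) := by
  have hK1 : ∀ v, σ v ∈ K ↔ v ∈ K := fun v => hK _ _ (by simp [SameCycle.refl])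
  have h1 := hX.sum_degree_add_le hσ hK b
  have h2 := D.arcs_le (K ∩ X b) (K ∩ X (!b))
  have h3 := D.arcs_le (K ∩ X (!b)) (K ∩ X b)
  rw [hX.card_inter_not hσ.1 hK1] at h2 h3
  have h4 : ((Kᶜ ∩ X b).card : ℤ) = a - (K ∩ X b).card := by
    have := hX.card_add_card_compl K b; omega
  rw [h4] at h1
  linarith

omit [DecidableEq V] in
theorem card_mul_le_sum_degree (hM : D.SideCondition a X) {b : Bool} {P : Finset V}
    (hP : P ⊆ X b) (h2 : 2 ≤ P.card) :
    P.card * (3 * (a : ℤ) - 1) ≤ 2 * ∑ v ∈ P, (D.degree v : ℤ) :=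
  card_mul_le_two_mul_sum h2 fun u hu v hv huv => hM b u (hP hu) v (hP hv) huv

/-- A cycle which is not a 2-cycle contains about half of the vertices, or more. -/
theorem le_two_mul_card (hX : D.IsBipartition a X) (hM : D.SideCondition a X) {σ : Perm V}
    (hσ : D.IsMaxCycleFactor σ) {K : Finset V} (hK : ∀ u v, σ.SameCycle u v → (u ∈ K ↔ v ∈ K))
    (b : Bool) (h2 : 2 ≤ (K ∩ X b).card) : a - 1 ≤ 2 * (K ∩ X b).card := by
  have hK1 : ∀ v, σ v ∈ K ↔ v ∈ K := fun v => hK _ _ (by simp [SameCycle.refl])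
  have h1 := hX.sum_degree_add_le' hσ hK b
  have h3 := card_mul_le_sum_degree (P := K ∩ X b) hM Finset.inter_subset_right h2
  have h4 := card_mul_le_sum_degree (P := K ∩ X (!b)) hM Finset.inter_subset_right
    (by rwa [hX.card_inter_not hσ.1 hK1])
  rw [hX.card_inter_not hσ.1 hK1] at h4
  have h5 : ((K ∩ X b).card : ℤ) * (3 * (a : ℤ) - 1) ≤
      (K ∩ X b).card * (2 * ((K ∩ X b).card + a)) := by linarith
  have h6 := le_of_mul_le_mul_left h5 (by omega)
  omega

/-- Apart from a 2-cycle, there is only room for one very long cycle: the vertices of the 2-cycle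
have a small degree sum, so all other degrees are large. -/
theorem le_card_add_two (hX : D.IsBipartition a X) (hM : D.SideCondition a X) {σ : Perm V}
    (hσ : D.IsMaxCycleFactor σ) {K L : Finset V}
    (hK : ∀ u v, σ.SameCycle u v → (u ∈ K ↔ v ∈ K)) (hL : ∀ u v, σ.SameCycle u v → (u ∈ L ↔ v ∈ L))
    (hKL : Disjoint K L) (b : Bool) (h1 : (K ∩ X b).card = 1) (h2 : 1 ≤ (L ∩ X b).card) :
    a ≤ (L ∩ X b).card + 2 := by
  have hK1 : ∀ v, σ v ∈ K ↔ v ∈ K := fun v => hK _ _ (by simp [SameCycle.refl])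
  have hL1 : ∀ v, σ v ∈ L ↔ v ∈ L := fun v => hL _ _ (by simp [SameCycle.refl])
  have hs := hX.sum_degree_add_le' hσ hK b
  have ht := hX.sum_degree_add_le' hσ hL b
  have h1' := h1
  rw [← hX.card_inter_not hσ.1 hK1] at h1'
  rw [h1] at hs
  obtain ⟨x, hx⟩ := Finset.card_eq_one.mp h1
  obtain ⟨y, hy⟩ := Finset.card_eq_one.mp h1'
  have key : ∀ c z, K ∩ X c = {z} →
      (L ∩ X c).card * (3 * (a : ℤ) - 1 - D.degree z) ≤ ∑ v ∈ L ∩ X c, (D.degree v : ℤ) := by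
    intro c z hz
    rw [← nsmul_eq_mul]
    refine Finset.card_nsmul_le_sum _ _ _ fun v hv => ?_
    have hz' : z ∈ K ∩ X c := by simp [hz]
    simp only [Finset.mem_inter] at hv hz'
    have := hM c v hv.2 z hz'.2 fun h => Finset.disjoint_left.mp hKL hz'.1 (h ▸ hv.1)
    linarith
  have h3 := key _ _ hx
  have h4 := key _ _ hy
  rw [hX.card_inter_not hσ.1 hL1] at h4
  rw [hx, hy] at hs
  simp only [Finset.sum_singleton] at hs
  push_cast at hs
  have h5 : ((L ∩ X b).card : ℤ) * (6 * a - 2 - D.degree x - D.degree y) ≤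
      (L ∩ X b).card * (2 * ((L ∩ X b).card + a)) := by linarith
  have h6 := le_of_mul_le_mul_left h5 (by omega)
  omega

omit [Fintype V] in
theorem one_le_card_inter (hX : D.IsBipartition a X) {σ : Perm V} (hσ : D.IsCycleFactor σ)
    {K : Finset V} (hK : ∀ v, σ v ∈ K ↔ v ∈ K) {v : V} (hv : v ∈ K) (b : Bool) :
    1 ≤ (K ∩ X b).card := by
  rcases hX.cover b v with h | h
  · exact Finset.card_pos.mpr ⟨v, by simp [hv, h]⟩
  · rw [← hX.card_inter_not hσ hK]
    exact Finset.card_pos.mpr ⟨v, by simp [hv, h]⟩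

/-- There are at most two cycles. -/
theorem sameCycle_or_sameCycle (hX : D.IsBipartition a X) (hM : D.SideCondition a X)
    (ha : 4 ≤ a) {σ : Perm V} (hσ : D.IsMaxCycleFactor σ) {x y : V} (hxy : ¬ σ.SameCycle x y)
    (z : V) : σ.SameCycle x z ∨ σ.SameCycle y z := by
  by_contra! hz
  have hd : ∀ {u v}, ¬ σ.SameCycle u v → Disjoint (cycleSet σ u) (cycleSet σ v) := fun h =>
    Finset.disjoint_left.mpr fun w hw hw' => by
      rw [mem_cycleSet] at hw hw'; exact h (hw.trans hw'.symm)
  have hI := fun w v => cycleSet_iff (σ := σ) w (u := σ v) (v := v) (by simp [SameCycle.refl])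
  have h1 := fun w => hX.one_le_card_inter hσ.1 (hI w)
    (mem_cycleSet.mpr (SameCycle.refl σ w)) true
  have h2 := fun w => hX.le_two_mul_card hM hσ (fun u v => cycleSet_iff w) true
  have h3 := fun w w' (h : ¬ σ.SameCycle w w') => hX.le_card_add_two hM hσ
    (fun u v => cycleSet_iff w) (fun u v => cycleSet_iff w') (hd h) true
  have h4 : (cycleSet σ x ∩ X true).card + (cycleSet σ y ∩ X true).card +
      (cycleSet σ z ∩ X true).card ≤ a := by
    rw [← hX.card true, ← Finset.card_union_of_disjoint, ← Finset.card_union_of_disjoint]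
    · refine Finset.card_le_card ?_
      simp only [Finset.union_subset_iff, Finset.inter_subset_right, and_self]
    · rw [Finset.disjoint_union_left]
      exact ⟨(hd hz.1).mono Finset.inter_subset_left Finset.inter_subset_left,
        (hd hz.2).mono Finset.inter_subset_left Finset.inter_subset_left⟩
    · exact (hd hxy).mono Finset.inter_subset_left Finset.inter_subset_left
  have := h3 x y hxy
  have := h3 x z hz.1
  have := h3 y z hz.2
  have := h3 z y fun h => hz.2 h.symm
  have := h1 x; have := h1 y; have := h1 z
  have := h2 x; have := h2 y; have := h2 z
  omega

/-! ### A cycle spanning a complete bipartite digraph -/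

/-- If `K` is a union of cycles which induces a complete bipartite digraph, then its vertices can be
exchanged freely, so no vertex outside `K` dominates a vertex of `K` while its successor is
dominated by a vertex of `K`. -/
theorem not_adj_and_adj (hX : D.IsBipartition a X) {σ : Perm V} (hσ : D.IsMaxCycleFactor σ)
    {K : Finset V} (hK : ∀ u v, σ.SameCycle u v → (u ∈ K ↔ v ∈ K))
    (hc : ∀ b, ∀ u ∈ K ∩ X b, ∀ v ∈ K ∩ X (!b), D.Adj u v) {y u w : V} (hy : y ∉ K) (hu : u ∈ K)
    (hw : w ∈ K) : ¬ (D.Adj y u ∧ D.Adj w (σ y)) := by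
  rintro ⟨h1, h2⟩
  have hK1 : ∀ v, σ v ∈ K ↔ v ∈ K := fun v => hK _ _ (by simp [SameCycle.refl])
  obtain ⟨b, hwb⟩ : ∃ b, w ∈ X b := (hX.cover true w).elim (fun h => ⟨_, h⟩) fun h => ⟨_, h⟩
  have hyb : y ∈ X b := by simpa using hX.adj' (hσ.1 y) (hX.adj _ _ _ h2 hwb)
  have hub : u ∈ X (!b) := hX.adj _ _ _ h1 hyb
  have hwb' : σ w ∈ X (!b) := hX.adj _ _ _ (hσ.1 w) hwb
  set π := swap (σ w) u with hπ
  have hπK : ∀ c v, v ∈ K ∩ X c → π v ∈ K ∩ X c := by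
    intro c v hv
    rw [hπ, swap_apply_def]
    simp only [Finset.mem_inter] at hv ⊢
    have hcb : v ∈ X (!b) → c = !b := fun h => by
      by_contra hne
      have : c = b := by cases b <;> cases c <;> simp_all
      exact hX.disj _ _ (this ▸ hv.2) h
    split_ifs with h3 h4
    · exact ⟨hu, hcb (h3 ▸ hwb') ▸ hub⟩
    · exact ⟨(hK1 w).mpr hw, hcb (h4 ▸ hub) ▸ hwb'⟩
    · exact hv
  have hπ' : ∀ v, v ∉ K → π v = v := fun v hv =>
    swap_apply_of_ne_of_ne (fun h => hv (h ▸ (hK1 w).mpr hw)) fun h => hv (h ▸ hu)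
  have hπi : π⁻¹ = π := swap_inv _ _
  have hπw : π w = w := swap_apply_of_ne_of_ne
    (fun h => hX.disj _ _ hwb (h ▸ hwb')) fun h => hX.disj _ _ hwb (h ▸ hub)
  have hF : D.IsCycleFactor (π * σ * π⁻¹) := by
    intro v
    rw [hπi, Perm.mul_apply, Perm.mul_apply]
    by_cases hv : v ∈ K
    · obtain ⟨c, hvc⟩ : ∃ c, v ∈ X c := (hX.cover true v).elim (fun h => ⟨_, h⟩) fun h => ⟨_, h⟩
      have h3 := hπK c v (by simp [hv, hvc])
      refine hc c _ (by simp [hv, hvc]) _ (hπK _ _ ?_)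
      rw [Finset.mem_inter] at h3 ⊢
      exact ⟨(hK1 _).mpr h3.1, hX.adj _ _ _ (hσ.1 _) h3.2⟩
    · rw [hπ' v hv, hπ' _ (by rwa [hK1])]
      exact hσ.1 v
  refine (hσ.conj π hF).not_adj (x := w) (y := y) (fun h => ?_) ⟨?_, ?_⟩
  · rw [sameCycle_conj, hπi, hπw, hπ' y hy] at h
    exact hy ((hK _ _ h).1 hw)
  · rw [hπi, Perm.mul_apply, Perm.mul_apply, hπ' y hy, hπ' _ (by rwa [hK1])]
    exact h2
  · rw [hπi, Perm.mul_apply, Perm.mul_apply, hπw, hπ, swap_apply_left]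
    exact h1

/-- If there are two cycles, one of them, on the set `K`, cannot be complete and of length at least
four: otherwise, going along the other cycle, there is a vertex which is not joined to `K`, and its
degree is too small. -/
theorem false_of_complete (hX : D.IsBipartition a X) (hM : D.SideCondition a X)
    (hs : D.IsStrong) (ha : 4 ≤ a) {σ : Perm V} (hσ : D.IsMaxCycleFactor σ)
    {K : Finset V} (hK : ∀ u v, σ.SameCycle u v → (u ∈ K ↔ v ∈ K))
    (hKc : ∀ u ∉ K, ∀ v ∉ K, σ.SameCycle u v)
    (hc : ∀ b, ∀ u ∈ K ∩ X b, ∀ v ∈ K ∩ X (!b), D.Adj u v) {y : V} (hy : y ∉ K)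
    (h2 : 2 ≤ (K ∩ X true).card) : False := by
  have hK1 : ∀ v, σ v ∈ K ↔ v ∈ K := fun v => hK _ _ (by simp [SameCycle.refl])
  obtain ⟨x, hx⟩ := Finset.card_pos.mp (show 0 < (K ∩ X true).card by omega)
  have hxK := (Finset.mem_inter.mp hx).1
  obtain ⟨v₁, u₁, hv₁, hu₁, huv₁⟩ := hs.exists_adj (Q := fun v => v ∉ K) hy (not_not.mpr hxK)
  obtain ⟨u₂, v₂, hu₂, hv₂, huv₂⟩ := hs.exists_adj (Q := fun v => v ∈ K) hxK hy
  have hw : ∃ z, z ∉ K ∧ (∃ u ∈ K, D.Adj z u) ∧ ¬ ∃ u ∈ K, D.Adj (σ z) u := by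
    by_contra! h
    obtain ⟨h3, u, hu, h4⟩ := SameCycle.induction
      (Q := fun z => z ∉ K ∧ ∃ u ∈ K, D.Adj z u)
      (fun z hz => ⟨by rw [hK1]; exact hz.1, h z hz.1 hz.2⟩)
      (hKc v₁ hv₁ (σ⁻¹ v₂) (by rw [← hK1]; simpa using hv₂))
      ⟨hv₁, u₁, not_not.mp hu₁, huv₁⟩
    exact hX.not_adj_and_adj hσ hK hc h3 hu hu₂ ⟨h4, by simpa using huv₂⟩
  obtain ⟨z, hzK, ⟨u, hu, hzu⟩, hz⟩ := hw
  have hin : ∀ u ∈ K, ¬ D.Adj u (σ z) := fun w hw h =>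
    hX.not_adj_and_adj hσ hK hc hzK hu hw ⟨hzu, h⟩
  obtain ⟨b, hb⟩ : ∃ b, σ z ∈ X b := (hX.cover true (σ z)).elim (fun h => ⟨_, h⟩) fun h => ⟨_, h⟩
  have hkb : ∀ b, (K ∩ X b).card = (K ∩ X true).card := by
    intro b; cases b
    · exact hX.card_inter_not hσ.1 hK1 true
    · rfl
  have hnb := fun b => hX.card_add_card_compl K b
  have hdeg : (D.degree (σ z) : ℤ) ≤ 2 * (a - (K ∩ X true).card) := by
    rw [hX.degree_eq_add K hb, Finset.sum_eq_zero, zero_add]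
    · calc _ ≤ ∑ u ∈ Kᶜ ∩ X (!b), (2 : ℤ) := Finset.sum_le_sum fun u _ => by
            have := D.arc_le_one (σ z) u
            have := D.arc_le_one u (σ z)
            omega
        _ ≤ _ := by
          have := hnb (!b)
          rw [hkb] at this
          simp only [Finset.sum_const, nsmul_eq_mul]
          omega
    · intro u hu
      have hu' := (Finset.mem_inter.mp hu).1
      rw [arc_of_not_adj (hin u hu'), arc_of_not_adj fun h => hz ⟨u, hu', h⟩, add_zero]
  have h3 : ((K ∩ X b).card : ℤ) * (3 * (a : ℤ) - 1 - D.degree (σ z)) ≤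
      ∑ v ∈ K ∩ X b, (D.degree v : ℤ) := by
    rw [← nsmul_eq_mul]
    refine Finset.card_nsmul_le_sum _ _ _ fun v hv => ?_
    rw [Finset.mem_inter] at hv
    have := hM b v hv.2 (σ z) hb fun h => hzK ((hK1 z).mp (h ▸ hv.1))
    linarith
  have h4 := card_mul_le_sum_degree (P := K ∩ X (!b)) hM Finset.inter_subset_right
    (by rwa [hkb])
  have h5 := hX.sum_degree_add_le' hσ hK b
  rw [hkb] at h3 h4 h5
  set k : ℤ := ((K ∩ X true).card : ℤ)
  have h6 : k * (2 * (3 * (a : ℤ) - 1 - D.degree (σ z)) + (3 * a - 1)) ≤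
      k * (4 * (k + a)) := by linarith
  have h7 := le_of_mul_le_mul_left h6 (by omega)
  omega

end IsBipartition

/-! ### A 2-cycle and a long cycle -/

/-- The permutation `σ * swap v (σ (σ v)) * swap v x` takes `σ v` and `σ (σ v)` out of the cycle of
`v`, as a cycle of their own, and inserts the 2-cycle of `x` in their place. A further exchange
merges the two remaining cycles. -/
theorem sameCycle_of_two_cycle {V : Type*} [Finite V] [DecidableEq V] {σ : Perm V} {v x : V}
    (hx : σ (σ x) = x) (hxσ : σ x ≠ x) (hvx : ¬ σ.SameCycle v x)
    (hall : ∀ u, σ.SameCycle v u ∨ u = x ∨ u = σ x) (hv : σ (σ v) ≠ v) (hvv : σ v ≠ v) {p q : V}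
    (hp : p ≠ σ v ∧ p ≠ σ (σ v)) (hq : q = σ v ∨ q = σ (σ v)) (s t : V) :
    (σ * swap v (σ (σ v)) * swap v x * swap p q).SameCycle s t := by
  set z := σ v with hz
  set w := σ z with hw
  set τ := σ * swap v w * swap v x with hτ
  have hvz : σ.SameCycle v z := ⟨1, rfl⟩
  have hvw : σ.SameCycle v w := hvz.trans ⟨1, rfl⟩
  have hsc : ∀ u, σ.SameCycle v u → u ≠ x := fun u hu h => hvx (h ▸ hu)
  have hvx' := hsc v (SameCycle.refl _ _)
  have hzx := hsc z hvz
  have hwx := hsc w hvw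
  have hwz : w ≠ z := fun h => hvv (σ.injective h)
  have hσx : ∀ u, σ.SameCycle v u → u ≠ σ x := fun u hu h =>
    hvx (hu.trans (SameCycle.symm ⟨1, by simp [h]⟩))
  have hτv : τ v = σ x := by
    simp [hτ, swap_apply_of_ne_of_ne hvx'.symm hwx.symm]
  have hτx : τ x = σ w := by simp [hτ]
  have hτw : τ w = z := by
    simp [hτ, swap_apply_of_ne_of_ne hv hwx, hz]
  have hτu : ∀ u, u ≠ v → u ≠ x → u ≠ w → τ u = σ u := fun u h1 h2 h3 => by
    simp [hτ, swap_apply_of_ne_of_ne h1 h2, swap_apply_of_ne_of_ne h1 h3]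
  have hτz : τ z = w := hτu z hvv hzx hwz.symm
  have hτx' : τ (σ x) = x := by
    rw [hτu _ (hσx v (SameCycle.refl _ _)).symm hxσ (hσx w hvw).symm, hx]
  have hstep : ∀ u, τ.SameCycle u (τ u) := fun u => ⟨1, rfl⟩
  have hvσ : τ.SameCycle v (σ x) := by simpa [hτv] using hstep v
  have hσx' : τ.SameCycle (σ x) x := by simpa [hτx'] using hstep (σ x)
  have hzw : τ.SameCycle z w := by simpa [hτz] using hstep z
  -- Following `σ` from a vertex of the long cycle outside `{z, w}`, one reaches `v` before `z`.
  have hlong : ∀ i : ℕ, ∀ u, u ≠ z → u ≠ w → σ.SameCycle v u → (σ ^ i) u = v →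
      τ.SameCycle u v := by
    intro i
    induction i with
    | zero => rintro u - - - rfl; exact SameCycle.refl _ _
    | succ i ih =>
      intro u h1 h2 h3 h4
      rcases eq_or_ne u v with rfl | huv
      · exact SameCycle.refl _ _
      have h5 := hτu u huv (hsc u h3) h2
      have h6 := ih (σ u) (fun h => huv (σ.injective h)) (fun h => h1 (σ.injective h))
        (h3.trans ⟨1, rfl⟩) (by rwa [pow_succ, Perm.mul_apply] at h4)
      rw [← h5] at h6
      exact (hstep u).trans h6
  have hout : ∀ u, u ≠ z → u ≠ w → τ.SameCycle u v := by
    intro u h1 h2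
    rcases hall u with h | rfl | rfl
    · obtain ⟨i, hi⟩ := h.symm.exists_nat_pow_eq
      exact hlong i u h1 h2 h hi
    · exact (hvσ.trans hσx').symm
    · exact hvσ.symm
  have hin : ∀ u, τ.SameCycle z u → u = z ∨ u = w := fun u hu =>
    SameCycle.induction (Q := fun u => u = z ∨ u = w)
      (by rintro _ (rfl | rfl)
          · exact Or.inr hτz
          · exact Or.inl hτw) hu (Or.inl rfl)
  have hqz : τ.SameCycle z q := by
    rcases hq with rfl | rfl
    · exact SameCycle.refl _ _
    · exact hzw
  have hpq : ¬ τ.SameCycle p q := fun h => by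
    rcases hin p (hqz.trans h.symm) with h1 | h1
    · exact hp.1 h1
    · exact hp.2 h1
  have hpv := hout p hp.1 hp.2
  have hfin : ∀ u, (τ * swap p q).SameCycle u p := by
    intro u
    by_cases hu : u = z ∨ u = w
    · have : τ.SameCycle u q := by
        rcases hu with rfl | rfl
        · exact hqz
        · exact hzw.symm.trans hqz
      exact (sameCycle_mul_swap hpq this).trans (sameCycle_mul_swap_self hpq).symm
    · rw [not_or] at hu
      exact sameCycle_mul_swap hpq ((hout u hu.1 hu.2).trans hpv.symm)
  exact (hfin s).trans (hfin t).symm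

namespace IsBipartition

variable {V : Type*} [Fintype V] [DecidableEq V] {D : Digraph V} {a : ℕ} {X : Bool → Finset V}

/-- Let the cycle factor consist of the 2-cycle on `κ true`, `κ false` and a long cycle. If `v`
dominates the 2-cycle, then the third vertex after `v` is not dominated by the 2-cycle: otherwise
the 2-cycle takes the place of the two vertices `z`, `w` after `v`. As `z` and `w` have few arcs to
the 2-cycle, they are joined to nearly all vertices of the long cycle, and can be inserted into it
elsewhere. -/
theorem not_adj_of_two_cycle (hX : D.IsBipartition a X) (hM : D.SideCondition a X)
    (ha : 4 ≤ a) (hH : ¬ D.IsHamiltonian) {σ : Perm V} (hσ : D.IsMaxCycleFactor σ)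
    {K : Finset V} (hK : ∀ u v, σ.SameCycle u v → (u ∈ K ↔ v ∈ K))
    (hKc : ∀ u ∉ K, ∀ v ∉ K, σ.SameCycle u v)
    (hc : ∀ b, ∀ u ∈ K ∩ X b, ∀ v ∈ K ∩ X (!b), D.Adj u v)
    {κ : Bool → V} (hκ : ∀ b, K ∩ X b = {κ b}) {b : Bool} {v : V} (hvK : v ∉ K) (hvb : v ∈ X b)
    (hvκ : D.Adj v (κ (!b))) : ¬ D.Adj (κ b) (σ (σ (σ v))) := by
  intro hκv
  have hK1 : ∀ v, σ v ∈ K ↔ v ∈ K := fun v => hK _ _ (by simp [SameCycle.refl])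
  have hK2 : ∀ v, σ v ∈ Kᶜ ↔ v ∈ Kᶜ := fun v => by simp [hK1]
  have hκK : ∀ b, κ b ∈ K ∧ κ b ∈ X b := fun b => by
    rw [← Finset.mem_inter, hκ]; exact Finset.mem_singleton_self _
  have hn : ∀ b, (Kᶜ ∩ X b).card + 1 = a := fun b => by
    have := hX.card_add_card_compl K b
    rw [hκ, Finset.card_singleton] at this
    omega
  have hσκ : ∀ b, σ (κ b) = κ (!b) := fun b => by
    have : σ (κ b) ∈ K ∩ X (!b) := by
      rw [Finset.mem_inter, hK1]; exact ⟨(hκK b).1, hX.adj _ _ _ (hσ.1 _) (hκK b).2⟩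
    rwa [hκ, Finset.mem_singleton] at this
  obtain ⟨z, hz⟩ : ∃ z, z = σ v := ⟨_, rfl⟩
  obtain ⟨w, hw⟩ : ∃ w, w = σ z := ⟨_, rfl⟩
  have hzb : z ∈ X (!b) := hz ▸ hX.adj _ _ _ (hσ.1 v) hvb
  have hwb : w ∈ X b := by simpa [← hw] using hX.adj _ _ _ (hσ.1 z) hzb
  have hzK : z ∉ K := by rwa [hz, hK1]
  have hwK : w ∉ K := by rwa [hw, hK1]
  have hside : ∀ {s t}, s ∈ X b → t ∈ X (!b) → s ≠ t := fun hs ht h => hX.disj _ _ hs (h ▸ ht)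
  have hwv : w ≠ v := by
    intro h
    have h1 : Kᶜ ∩ X b ⊆ {v} := fun u hu => by
      simp only [Finset.mem_inter, Finset.mem_compl, Finset.mem_singleton] at hu ⊢
      have := SameCycle.induction (Q := fun u => u = v ∨ u = z)
        (by rintro _ (rfl | rfl)
            · exact Or.inr hz.symm
            · exact Or.inl (hw.symm.trans h)) (hKc v hvK u hu.1) (Or.inl rfl)
      exact this.resolve_right (hside hu.2 hzb)
    have h2 := Finset.card_le_card h1
    have := hn b
    rw [Finset.card_singleton] at h2
    omega
  rw [← hz, ← hw] at hκv
  -- A hamiltonian cycle arises from a vertex `p` into whose place `z` and `w` can be inserted.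
  have hins : ∀ p q r, D.Adj w z ∨ q = w → p ∉ K → p ≠ v → p ≠ z → p ≠ w →
      (q = z ∧ r = w ∨ q = w ∧ r = z) → D.Adj p r → ¬ D.Adj q (σ p) := by
    intro p q r hwz hpK hpv hpz hpw hqr hpr hqp
    have hne : ∀ {s t}, s ∉ K → t ∈ K → s ≠ t := fun hs ht h => hs (h ▸ ht)
    have hvκ' := hne hvK (hκK b).1
    have hwκ' := hne hwK (hκK b).1
    have hzκ' := hne hzK (hκK b).1
    have hzv : z ≠ v := (hside hvb hzb).symm
    have hzw : z ≠ w := (hside hwb hzb).symm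
    have hτw : (σ * swap v w * swap v (κ b)) w = z := by
      simp [swap_apply_of_ne_of_ne hwv hwκ', hz]
    have hτu : ∀ u, u ≠ v → u ≠ κ b → u ≠ w → (σ * swap v w * swap v (κ b)) u = σ u :=
      fun u h1 h2 h3 => by
        simp [swap_apply_of_ne_of_ne h1 h2, swap_apply_of_ne_of_ne h1 h3]
    have hτp := hτu p hpv (hne hpK (hκK b).1) hpw
    have hτz : (σ * swap v w * swap v (κ b)) z = w := by rw [hτu z hzv hzκ' hzw, hw]
    refine hH (IsCycleFactor.isHamiltonian
      (σ := σ * swap v w * swap v (κ b) * swap p q) ?_ ?_ fun s t => ?_)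
    · refine IsCycleFactor.mul_swap (fun u h1 h2 => ?_) ?_ ?_
      · rcases eq_or_ne u w with rfl | huw
        · rw [hτw]
          exact hwz.resolve_right h2.symm
        rcases eq_or_ne u v with rfl | huv
        · simpa [swap_apply_of_ne_of_ne hvκ'.symm hwκ'.symm, hσκ] using hvκ
        rcases eq_or_ne u (κ b) with rfl | huκ
        · simpa using hκv
        rw [hτu u huv huκ huw]
        exact hσ.1 u
      · rcases hqr with ⟨rfl, rfl⟩ | ⟨rfl, rfl⟩
        · rwa [hτz]
        · rwa [hτw]
      · rwa [hτp]
    · rw [hX.card_eq]; omega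
    · have := sameCycle_of_two_cycle (σ := σ) (v := v) (x := κ b) (p := p) (q := q)
        (by rw [hσκ, hσκ, Bool.not_not])
        (by rw [hσκ]; exact (hside (hκK b).2 (hκK (!b)).2).symm)
        (fun h => hvK ((hK _ _ h).mpr (hκK b).1)) (fun u => ?_)
        (by rwa [← hz, ← hw]) (by rwa [← hz]) (by rw [← hz, ← hw]; exact ⟨hpz, hpw⟩)
        (by rw [← hz, ← hw]; exact hqr.imp And.left And.left) s t
      · rwa [← hz, ← hw] at this
      · by_cases hu : u ∈ K
        · refine Or.inr ?_
          rw [hσκ]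
          rcases hX.cover b u with h | h
          · have : u ∈ K ∩ X b := by simp [hu, h]
            rw [hκ] at this
            exact Or.inl (Finset.mem_singleton.mp this)
          · have : u ∈ K ∩ X (!b) := by simp [hu, h]
            rw [hκ] at this
            exact Or.inr (Finset.mem_singleton.mp this)
        · exact Or.inl (hKc v hvK u hu)
  have hd := hX.sum_degree_add_le' hσ hK b
  rw [hκ, hκ] at hd
  simp only [Finset.sum_singleton, Finset.card_singleton] at hd
  have hdz := hM (!b) z hzb (κ (!b)) (hκK _).2 fun h => hzK (h ▸ (hκK _).1)
  have hdw := hM b w hwb (κ b) (hκK _).2 fun h => hwK (h ▸ (hκK _).1)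
  have hez := hX.degree_eq_add K hzb
  have hew := hX.degree_eq_add K hwb
  have h1 : D.arc (κ b) z = 0 := arc_of_not_adj fun h =>
    hX.not_adj_and_adj hσ hK hc hvK (hκK (!b)).1 (hκK b).1 ⟨hvκ, hz ▸ h⟩
  have h2 : D.arc w (κ (!b)) = 0 := arc_of_not_adj fun h =>
    hX.not_adj_and_adj hσ hK hc hwK (hκK (!b)).1 (hκK b).1 ⟨h, hκv⟩
  have h3 : D.arc z (κ b) + D.arc (κ (!b)) w ≤ 1 := by
    have := hX.not_adj_and_adj hσ hK hc hzK (hκK b).1 (hκK (!b)).1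
    rw [← hw] at this
    exact arc_add_arc_le_one this
  rw [Bool.not_not, hκ, Finset.sum_singleton, h1, Finset.sum_add_distrib,
    ← Bool.not_not b, hX.sum_inter_not hσ.1 hK2 (!b) fun u => D.arc z u] at hez
  rw [hκ, Finset.sum_singleton, h2, Finset.sum_add_distrib,
    hX.sum_inter_not hσ.1 hK2 b fun u => D.arc w u] at hew
  rw [Bool.not_not] at hez
  have hS : (∑ u ∈ Kᶜ ∩ X (!b), (D.arc u w + D.arc z (σ u))) +
      ∑ t ∈ Kᶜ ∩ X b, (D.arc t z + D.arc w (σ t)) ≥ 4 * a - 5 := by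
    rw [Finset.sum_add_distrib, Finset.sum_add_distrib]
    push_cast at hd
    linarith
  have hn1 := hn b
  have hn2 := hn (!b)
  have hzm : z ∈ Kᶜ ∩ X (!b) := by simp [hzK, hzb]
  have hvm : v ∈ Kᶜ ∩ X b := by simp [hvK, hvb]
  have hwm : w ∈ Kᶜ ∩ X b := by simp [hwK, hwb]
  by_cases hwz : D.Adj w z
  · have hS1 : ∑ u ∈ Kᶜ ∩ X (!b), (D.arc u w + D.arc z (σ u)) ≤
        ∑ u ∈ Kᶜ ∩ X (!b), (1 + if u = z then 1 else 0 : ℤ) := by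
      refine Finset.sum_le_sum fun u hu => ?_
      simp only [Finset.mem_inter, Finset.mem_compl] at hu
      have := D.arc_le_one u w
      have := D.arc_le_one z (σ u)
      split_ifs with h
      · omega
      · have := arc_add_arc_le_one (not_and.mpr <| hins u z w (Or.inl hwz) hu.1
          (hside hvb hu.2).symm h (hside hwb hu.2).symm (Or.inl ⟨rfl, rfl⟩))
        omega
    have hS2 : ∑ t ∈ Kᶜ ∩ X b, (D.arc t z + D.arc w (σ t)) ≤
        ∑ t ∈ Kᶜ ∩ X b, (1 + (if t = v then 1 else 0) + if t = w then 1 else 0 : ℤ) := by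
      refine Finset.sum_le_sum fun t ht => ?_
      simp only [Finset.mem_inter, Finset.mem_compl] at ht
      have := D.arc_le_one t z
      have := D.arc_le_one w (σ t)
      split_ifs with h h' h'
      · omega
      · omega
      · omega
      · have := arc_add_arc_le_one (not_and.mpr <| hins t w z (Or.inr rfl) ht.1 h
          (hside ht.2 hzb) h' (Or.inr ⟨rfl, rfl⟩))
        omega
    simp only [Finset.sum_add_distrib, Finset.sum_ite_eq', hzm, hvm, hwm, if_true,
      Finset.sum_const, nsmul_eq_mul, mul_one] at hS1 hS2 hS
    omega
  · have hS1 : ∑ u ∈ Kᶜ ∩ X (!b), (D.arc u w + D.arc z (σ u)) ≤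
        ∑ u ∈ Kᶜ ∩ X (!b), (2 : ℤ) := by
      refine Finset.sum_le_sum fun u hu => ?_
      have := D.arc_le_one u w
      have := D.arc_le_one z (σ u)
      omega
    have hS2 : ∑ t ∈ Kᶜ ∩ X b, (D.arc t z + D.arc w (σ t)) ≤ ∑ t ∈ Kᶜ ∩ X b, (1 : ℤ) := by
      refine Finset.sum_le_sum fun t ht => ?_
      simp only [Finset.mem_inter, Finset.mem_compl] at ht
      rcases eq_or_ne t v with rfl | h
      · rw [← hz, arc_of_not_adj hwz]
        have := D.arc_le_one t z
        omega
      rcases eq_or_ne t w with rfl | h'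
      · rw [arc_of_not_adj hwz]
        have := D.arc_le_one t (σ t)
        omega
      have := arc_add_arc_le_one (not_and.mpr <| hins t w z (Or.inr rfl) ht.1 h
        (hside ht.2 hzb) h' (Or.inr ⟨rfl, rfl⟩))
      omega
    simp only [Finset.sum_const, nsmul_eq_mul] at hS1 hS2
    omega

/-- A 2-cycle and a long cycle are impossible in a non-hamiltonian digraph. -/
theorem false_of_two_cycle (hX : D.IsBipartition a X) (hM : D.SideCondition a X)
    (hs : D.IsStrong) (ha : 4 ≤ a) (hH : ¬ D.IsHamiltonian) {σ : Perm V}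
    (hσ : D.IsMaxCycleFactor σ) {K : Finset V} (hK : ∀ u v, σ.SameCycle u v → (u ∈ K ↔ v ∈ K))
    (hKc : ∀ u ∉ K, ∀ v ∉ K, σ.SameCycle u v)
    (hc : ∀ b, ∀ u ∈ K ∩ X b, ∀ v ∈ K ∩ X (!b), D.Adj u v)
    (h1 : (K ∩ X true).card = 1) : False := by
  have hK1 : ∀ v, σ v ∈ K ↔ v ∈ K := fun v => hK _ _ (by simp [SameCycle.refl])
  have hK2 : ∀ v, σ v ∈ Kᶜ ↔ v ∈ Kᶜ := fun v => by simp [hK1]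
  have hex : ∀ b, ∃ x, K ∩ X b = {x} := by
    intro b
    rw [← Finset.card_eq_one]
    cases b
    · rw [← h1]; exact hX.card_inter_not hσ.1 hK1 true
    · exact h1
  choose κ hκ using hex
  have hκK : ∀ b, κ b ∈ K ∧ κ b ∈ X b := fun b => by
    rw [← Finset.mem_inter, hκ]; exact Finset.mem_singleton_self _
  have hn : ∀ b, (Kᶜ ∩ X b).card + 1 = a := fun b => by
    have := hX.card_add_card_compl K b
    rw [hκ, Finset.card_singleton] at this
    omega
  classical
  -- The sets `A b` and `B b` consist of the vertices whose successor is dominated by the 2-cycle,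
  -- and of those which dominate the 2-cycle.
  set A : Bool → Finset V := fun b => (Kᶜ ∩ X b).filter fun v => D.Adj (κ b) (σ v) with hA
  set B : Bool → Finset V := fun b => (Kᶜ ∩ X b).filter fun v => D.Adj v (κ (!b)) with hB
  have hAm : ∀ {b v}, v ∈ A b ↔ (v ∉ K ∧ v ∈ X b) ∧ D.Adj (κ b) (σ v) := by simp [hA]
  have hBm : ∀ {b v}, v ∈ B b ↔ (v ∉ K ∧ v ∈ X b) ∧ D.Adj v (κ (!b)) := by simp [hB]
  have hAB : ∀ b, Disjoint (A b) (B b) := fun b => Finset.disjoint_left.mpr fun v h2 h3 =>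
    hX.not_adj_and_adj hσ hK hc (hAm.mp h2).1.1 (hκK (!b)).1 (hκK b).1 ⟨(hBm.mp h3).2, (hAm.mp h2).2⟩
  have hle : ∀ b, (A b).card + (B b).card ≤ (Kᶜ ∩ X b).card := fun b => by
    rw [← Finset.card_union_of_disjoint (hAB b)]
    exact Finset.card_le_card (Finset.union_subset (Finset.filter_subset _ _)
      (Finset.filter_subset _ _))
  have hdκ : ∀ b, (D.degree (κ b) : ℤ) ≤ 2 + ((A b).card + (B (!b)).card) := by
    intro b
    rw [hX.degree_eq_add K (hκK b).2, hκ, Finset.sum_singleton, Finset.sum_add_distrib,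
      hX.sum_inter_not hσ.1 hK2 b fun u => D.arc (κ b) u]
    have h3 : ∑ v ∈ Kᶜ ∩ X b, D.arc (κ b) (σ v) = (A b).card := by
      simp [hA, arc, Finset.sum_boole]
    have h4 : ∑ v ∈ Kᶜ ∩ X (!b), D.arc v (κ b) = (B (!b)).card := by
      simp [hB, arc, Finset.sum_boole]
    rw [h3, h4]
    have := D.arc_le_one (κ b) (κ (!b))
    have := D.arc_le_one (κ (!b)) (κ b)
    omega
  have hdv : ∀ b v, v ∉ K → v ∈ X b →
      (a : ℤ) - 1 - ((A b).card + (B (!b)).card) ≤ D.arc v (κ (!b)) + D.arc (κ (!b)) v := by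
    intro b v hvK hvb
    have h2 := hM b v hvb (κ b) (hκK b).2 fun h => hvK (h ▸ (hκK b).1)
    have h3 := hdκ b
    have h4 : ∑ u ∈ Kᶜ ∩ X (!b), (D.arc v u + D.arc u v) ≤ ∑ u ∈ Kᶜ ∩ X (!b), (2 : ℤ) :=
      Finset.sum_le_sum fun u _ => by
        have := D.arc_le_one v u
        have := D.arc_le_one u v
        omega
    rw [hX.degree_eq_add K hvb, hκ, Finset.sum_singleton] at h2
    simp only [Finset.sum_const, nsmul_eq_mul] at h4
    have := hn (!b)
    omega
  have hdb : ∀ b, a ≤ (A b).card + (B (!b)).card + 3 := by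
    intro b
    obtain ⟨v, hv⟩ : (Kᶜ ∩ X b).Nonempty := Finset.card_pos.mp (by have := hn b; omega)
    simp only [Finset.mem_inter, Finset.mem_compl] at hv
    have := hdv b v hv.1 hv.2
    have := D.arc_le_one v (κ (!b))
    have := D.arc_le_one (κ (!b)) v
    omega
  -- If both sets are non-empty on one side, then some vertex of that side is in neither of them, and
  -- the neighbours of the 2-cycle are too few for the degree condition.
  have hboth : ∀ b, (A b).Nonempty → (B b).Nonempty →
      (A b).card + (B b).card + 1 ≤ (Kᶜ ∩ X b).card ∧
      a ≤ (A b).card + (B (!b)).card + 2 ∧ a ≤ (A (!b)).card + (B b).card + 2 ∧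
      2 * a ≤ (A b).card + (B (!b)).card + (A (!b)).card + (B b).card + 3 := by
    rintro b ⟨s, hsA⟩ ⟨t, htB⟩
    obtain ⟨y, hyB, hyB'⟩ : ∃ y ∈ B b, σ (σ y) ∉ B b := by
      by_contra! h
      have h2 := SameCycle.induction (σ := σ) (Q := fun u => u ∈ B b ∨ ∃ u' ∈ B b, u = σ u')
        (by rintro u (hu | ⟨u', hu', rfl⟩)
            · exact Or.inr ⟨u, hu, rfl⟩
            · exact Or.inl (h u' hu')) (hKc t (hBm.mp htB).1.1 s (hAm.mp hsA).1.1) (Or.inl htB)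
      rcases h2 with h2 | ⟨u', hu', rfl⟩
      · exact Finset.disjoint_left.mp (hAB b) hsA h2
      · exact hX.disj b _ (hAm.mp hsA).1.2 (hX.adj _ _ _ (hσ.1 u') (hBm.mp hu').1.2)
    obtain ⟨⟨hyK, hyb⟩, hy⟩ := hBm.mp hyB
    have hσyK : σ y ∉ K := by rwa [hK1]
    have hσyK' : σ (σ y) ∉ K := by rwa [hK1]
    have hσyb : σ y ∈ X (!b) := hX.adj _ _ _ (hσ.1 y) hyb
    have hσyb' : σ (σ y) ∈ X b := by simpa using hX.adj _ _ _ (hσ.1 _) hσyb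
    have hyA : σ (σ y) ∉ A b := fun h =>
      hX.not_adj_of_two_cycle hM ha hH hσ hK hKc hc hκ hyK hyb hy (hAm.mp h).2
    constructor
    · rw [← Finset.card_union_of_disjoint (hAB b), Nat.add_one_le_iff]
      refine Finset.card_lt_card ⟨Finset.union_subset (Finset.filter_subset _ _)
        (Finset.filter_subset _ _), fun h => ?_⟩
      have := h (show σ (σ y) ∈ Kᶜ ∩ X b by simp [hσyK', hσyb'])
      rw [Finset.mem_union] at this
      exact this.elim hyA hyB'
    · have h2 := arc_add_arc_le_one (hX.not_adj_and_adj hσ hK hc hσyK (hκK b).1 (hκK (!b)).1)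
      have h3 := hdv b _ hσyK' hσyb'
      rw [arc_of_not_adj fun h => hyB' (hBm.mpr ⟨⟨hσyK', hσyb'⟩, h⟩), zero_add] at h3
      have h4 := hdv (!b) _ hσyK hσyb
      rw [Bool.not_not, arc_of_not_adj (u := κ b) fun h => hX.not_adj_and_adj hσ hK hc hyK
        (hκK (!b)).1 (hκK b).1 ⟨hy, h⟩, add_zero] at h4
      have := D.arc_le_one (σ y) (κ b)
      have := D.arc_le_one (κ (!b)) (σ (σ y))
      omega
  obtain ⟨y, hy⟩ : (Kᶜ ∩ X true).Nonempty := Finset.card_pos.mp (by have := hn true; omega)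
  have hyK : y ∉ K := by simpa using (Finset.mem_inter.mp hy).1
  have hKm : ∀ {u b}, u ∈ K → u ∈ X b → u = κ b := fun hu hb =>
    Finset.mem_singleton.mp (hκ _ ▸ Finset.mem_inter.mpr ⟨hu, hb⟩)
  have hBex : ∃ b, (B b).Nonempty := by
    obtain ⟨v, u, hv, hu, hvu⟩ := hs.exists_adj (Q := fun v => v ∉ K) hyK
      (not_not.mpr (hκK true).1)
    obtain ⟨b, hb⟩ : ∃ b, v ∈ X b := (hX.cover true v).elim (fun h => ⟨_, h⟩) fun h => ⟨_, h⟩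
    exact ⟨b, v, hBm.mpr ⟨⟨hv, hb⟩, hKm (not_not.mp hu) (hX.adj _ _ _ hvu hb) ▸ hvu⟩⟩
  have hAex : ∃ b, (A b).Nonempty := by
    obtain ⟨u, v, hu, hv, huv⟩ := hs.exists_adj (Q := fun v => v ∈ K) (hκK true).1 hyK
    obtain ⟨b, hb⟩ : ∃ b, u ∈ X b := (hX.cover true u).elim (fun h => ⟨_, h⟩) fun h => ⟨_, h⟩
    have hvb := hX.adj _ _ _ huv hb
    refine ⟨b, σ⁻¹ v, hAm.mpr ⟨⟨by rw [← hK1]; simpa using hv, ?_⟩, ?_⟩⟩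
    · have := hX.adj' (b := !b) (hσ.1 (σ⁻¹ v)) (by simpa using hvb)
      rwa [Bool.not_not] at this
    · rw [← hKm hu hb]; simpa using huv
  simp only [← Finset.card_pos, Bool.exists_bool] at hAex hBex hboth
  have h3 := hboth true
  have h4 := hboth false
  have h5 := hle true
  have h6 := hle false
  have h7 := hn true
  have h8 := hn false
  have h9 := hdb true
  have h10 := hdb false
  simp only [Bool.not_true, Bool.not_false] at h3 h4 h9 h10
  omega

end IsBipartition

/-! ### Cycle factors of digraphs of order at least eight -/

namespace IsBipartition

variable {V : Type*} [Fintype V] [DecidableEq V] {D : Digraph V} {a : ℕ} {X : Bool → Finset V}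

/-- If the cycle factor has exactly two cycles, neither of them spans a complete bipartite
digraph. -/
theorem not_complete (hX : D.IsBipartition a X) (hM : D.SideCondition a X)
    (hs : D.IsStrong) (ha : 4 ≤ a) (hH : ¬ D.IsHamiltonian) {σ : Perm V}
    (hσ : D.IsMaxCycleFactor σ) {K : Finset V} (hK : ∀ u v, σ.SameCycle u v → (u ∈ K ↔ v ∈ K))
    (hKc : ∀ u ∉ K, ∀ v ∉ K, σ.SameCycle u v) {x y : V} (hx : x ∈ K) (hy : y ∉ K) :
    ¬ ∀ b, ∀ u ∈ K ∩ X b, ∀ v ∈ K ∩ X (!b), D.Adj u v := by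
  intro hc
  have h1 := hX.one_le_card_inter hσ.1 (fun v => hK _ _ (by simp [SameCycle.refl])) hx true
  rcases h1.eq_or_lt with h2 | h2
  · exact hX.false_of_two_cycle hM hs ha hH hσ hK hKc hc h2.symm
  · exact hX.false_of_complete hM hs ha hσ hK hKc hc hy h2

omit [Fintype V] in
theorem complete_of_two_mul_le_arcs (hX : D.IsBipartition a X) {σ : Perm V}
    (hσ : D.IsCycleFactor σ) {K : Finset V} (hK : ∀ v, σ v ∈ K ↔ v ∈ K)
    (h : 2 * ((K ∩ X true).card * (K ∩ X true).card : ℤ) ≤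
      D.arcs (K ∩ X true) (K ∩ X false) + D.arcs (K ∩ X false) (K ∩ X true)) :
    ∀ b, ∀ u ∈ K ∩ X b, ∀ v ∈ K ∩ X (!b), D.Adj u v := by
  have hk : (K ∩ X false).card = (K ∩ X true).card := hX.card_inter_not hσ hK true
  have h1 := D.arcs_le (K ∩ X true) (K ∩ X false)
  have h2 := D.arcs_le (K ∩ X false) (K ∩ X true)
  rw [hk] at h1 h2
  intro b u hu v hv
  cases b
  · exact adj_of_card_mul_card_le_arcs (by rw [hk, Bool.not_false]; linarith) hu hv
  · exact adj_of_card_mul_card_le_arcs (by rw [Bool.not_true, hk]; linarith) hu hv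

/-- If one of the two cycles is a 2-cycle, or is shorter than the other one, then it is complete; if
both have the same length `a`, then `3 * a - 1` is odd and one of them is complete. -/
theorem isHamiltonian_of_isCycleFactor (hX : D.IsBipartition a X) (hM : D.SideCondition a X)
    (hs : D.IsStrong) (ha : 4 ≤ a) {σ : Perm V} (hσ : D.IsCycleFactor σ) :
    D.IsHamiltonian := by
  by_contra hH
  obtain ⟨σ, hσ⟩ := hσ.exists_isMaxCycleFactor
  have hxy : ∃ x y, ¬ σ.SameCycle x y := by
    by_contra! h
    exact hH (hσ.1.isHamiltonian (by rw [hX.card_eq]; omega) h)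
  obtain ⟨x, y, hxy⟩ := hxy
  set K := cycleSet σ x with hKdef
  have hK : ∀ u v, σ.SameCycle u v → (u ∈ K ↔ v ∈ K) := fun u v => cycleSet_iff x
  have hL : ∀ u v, σ.SameCycle u v → (u ∈ Kᶜ ↔ v ∈ Kᶜ) := fun u v h => by
    simp only [Finset.mem_compl, hK u v h]
  have hK1 : ∀ v, σ v ∈ K ↔ v ∈ K := fun v => hK _ _ (by simp [SameCycle.refl])
  have hL1 : ∀ v, σ v ∈ Kᶜ ↔ v ∈ Kᶜ := fun v => hL _ _ (by simp [SameCycle.refl])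
  have hKc : ∀ u ∉ K, ∀ v ∉ K, σ.SameCycle u v := by
    intro u hu v hv
    rw [hKdef, mem_cycleSet] at hu hv
    have h1 := (hX.sameCycle_or_sameCycle hM ha hσ hxy u).resolve_left hu
    have h2 := (hX.sameCycle_or_sameCycle hM ha hσ hxy v).resolve_left hv
    exact h1.symm.trans h2
  have hLc : ∀ u ∉ Kᶜ, ∀ v ∉ Kᶜ, σ.SameCycle u v := by
    intro u hu v hv
    rw [hKdef, Finset.mem_compl, not_not, mem_cycleSet] at hu hv
    exact hu.symm.trans hv
  have hxK : x ∈ K := mem_cycleSet.mpr (SameCycle.refl _ _)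
  have hyK : y ∉ K := fun h => hxy (mem_cycleSet.mp h)
  have hKn := hX.not_complete hM hs ha hH hσ hK hKc hxK hyK
  have hLn := hX.not_complete hM hs ha hH hσ hL hLc (x := y) (y := x) (by simpa using hyK)
    (by simpa using hxK)
  have hone : ∀ {M : Finset V}, (∀ v, σ v ∈ M ↔ v ∈ M) → (M ∩ X true).card = 1 →
      ∀ b, ∀ u ∈ M ∩ X b, ∀ v ∈ M ∩ X (!b), D.Adj u v := by
    intro M hM h1 b u hu v hv
    have h2 : (M ∩ X (!b)).card = 1 := by
      cases b
      · exact h1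
      · exact (hX.card_inter_not hσ.1 hM true).trans h1
    rw [Finset.mem_inter] at hu
    have h3 : σ u ∈ M ∩ X (!b) :=
      Finset.mem_inter.mpr ⟨(hM u).mpr hu.1, hX.adj _ _ _ (hσ.1 u) hu.2⟩
    rw [Finset.card_le_one.mp h2.le v hv _ h3]
    exact hσ.1 u
  have hk1 : (K ∩ X true).card ≠ 1 := fun h => hKn (hone hK1 h)
  have hn1 : (Kᶜ ∩ X true).card ≠ 1 := fun h => hLn (hone hL1 h)
  have hk2 := hX.one_le_card_inter hσ.1 hK1 hxK true
  have hn2 := hX.one_le_card_inter hσ.1 hL1 (v := y) (by simpa using hyK) true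
  have hk3 := hX.le_two_mul_card hM hσ hK true (by omega)
  have hn3 := hX.le_two_mul_card hM hσ hL true (by omega)
  have hkn := hX.card_add_card_compl K true
  have hKf : (K ∩ X false).card = (K ∩ X true).card := hX.card_inter_not hσ.1 hK1 true
  have hLf : (Kᶜ ∩ X false).card = (Kᶜ ∩ X true).card := hX.card_inter_not hσ.1 hL1 true
  have hKs := hX.sum_degree_add_le hσ hK true
  have hLs := hX.sum_degree_add_le hσ hL true
  rw [compl_compl] at hLs
  have hKa := fun h => hKn (hX.complete_of_two_mul_le_arcs hσ.1 hK1 h)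
  have hLa := fun h => hLn (hX.complete_of_two_mul_le_arcs hσ.1 hL1 h)
  have hge : ∀ {M : Finset V} {b}, 2 ≤ (M ∩ X b).card →
      (M ∩ X b).card * (3 * (a : ℤ) - 1) ≤ 2 * ∑ v ∈ M ∩ X b, (D.degree v : ℤ) :=
    fun h => card_mul_le_sum_degree hM Finset.inter_subset_right h
  have hKt := hge (M := K) (b := true) (by omega)
  have hKf' := hge (M := K) (b := false) (by omega)
  have hLt := hge (M := Kᶜ) (b := true) (by omega)
  have hLf' := hge (M := Kᶜ) (b := false) (by omega)
  have hsum : ∀ b, (a : ℤ) * (K ∩ X true).card * 3 - 1 ≤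
      ∑ v ∈ K ∩ X b, (D.degree v : ℤ) + ∑ v ∈ Kᶜ ∩ X b, (D.degree v : ℤ) ∨
      a ≠ 2 * (K ∩ X true).card := by
    intro b
    by_cases h : a = 2 * (K ∩ X true).card
    · left
      have h1 := card_mul_sub_one_le_sum (P := X b) (f := fun v => (D.degree v : ℤ))
        (t := 3 * (K ∩ X true).card) (by rw [hX.card]; omega) fun u hu v hv huv => by
          have := hM b u hu v hv huv; omega
      rw [hX.card] at h1
      have h2 : ∑ v ∈ X b, (D.degree v : ℤ) =
          ∑ v ∈ K ∩ X b, (D.degree v : ℤ) + ∑ v ∈ Kᶜ ∩ X b, (D.degree v : ℤ) := by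
        rw [← Finset.sum_union]
        · congr 1
          ext u
          by_cases hu : u ∈ K <;> simp [hu]
        · exact Finset.disjoint_left.mpr fun u => by simp +contextual
      linarith
    · exact Or.inr h
  have hst := hsum true
  have hsf := hsum false
  simp only [Bool.not_true, hKf, hLf] at hKs hLs hKf' hLf'
  generalize D.arcs (K ∩ X true) (K ∩ X false) + D.arcs (K ∩ X false) (K ∩ X true) = I at *
  generalize D.arcs (Kᶜ ∩ X true) (Kᶜ ∩ X false) + D.arcs (Kᶜ ∩ X false) (Kᶜ ∩ X true) = J at *
  generalize (K ∩ X true).card = k at *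
  generalize (Kᶜ ∩ X true).card = n at *
  obtain h | h | h : a = 2 * k ∨ a = 2 * k + 1 ∨ a = 2 * n + 1 := by omega
  · have h1 := hst.resolve_right (not_not.mpr h)
    have h2 := hsf.resolve_right (not_not.mpr h)
    obtain rfl : n = k := by omega
    subst h
    push_cast at *
    by_cases h3 : 2 * ((n : ℤ) * n) ≤ I
    · exact hKa h3
    · exact hLa (by linarith [not_le.mp h3, Int.add_one_le_iff.mpr (not_le.mp h3)])
  · obtain rfl : n = k + 1 := by omega
    subst h
    push_cast at *
    exact hKa (by linarith)
  · obtain rfl : k = n + 1 := by omega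
    subst h
    push_cast at *
    exact hLa (by linarith)

end IsBipartition

/-! ### Digraphs without a cycle factor -/

/-- Applied to the neighbours of a vertex: if `f` and `g` indicate the arcs in the two directions and
the arcs of the first kind end in `U`, then this bounds the degree and describes equality. -/
theorem sum_add_le_card_add_card {ι : Type*} {Y U : Finset ι} (hU : U ⊆ Y)
    {f g : ι → ℤ} (hf : ∀ u, f u ≤ 1) (hg : ∀ u, g u ≤ 1) (h0 : ∀ u ∈ Y, u ∉ U → f u = 0) :
    ∑ u ∈ Y, (f u + g u) ≤ Y.card + U.card ∧
      ((Y.card + U.card : ℤ) ≤ ∑ u ∈ Y, (f u + g u) →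
        (∀ u ∈ U, f u = 1) ∧ ∀ u ∈ Y, g u = 1) := by
  classical
  have h1 : ∑ u ∈ Y, (1 + if u ∈ U then 1 else 0 : ℤ) = Y.card + U.card := by
    rw [Finset.sum_add_distrib, Finset.sum_boole, Finset.filter_mem_eq_inter,
      Finset.inter_eq_right.mpr hU]
    simp
  have h2 : ∀ u ∈ Y, f u + g u ≤ 1 + if u ∈ U then 1 else 0 := by
    intro u hu
    have := hf u
    have := hg u
    split_ifs with h
    · omega
    · have := h0 u hu h
      omega
  have h3 := Finset.sum_le_sum h2
  rw [h1] at h3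
  refine ⟨h3, fun h4 => ?_⟩
  have h5 := (Finset.sum_eq_sum_iff_of_le h2).mp (by rw [h1]; exact le_antisymm h3 h4)
  constructor
  · intro u hu
    have := h5 u (hU hu)
    rw [if_pos hu] at this
    have := hf u
    have := hg u
    omega
  · intro u hu
    have := h5 u hu
    have := hf u
    have := hg u
    split_ifs at * with h
    · omega
    · have := h0 u hu h
      omega

namespace IsBipartition

variable {V : Type*} [Fintype V] [DecidableEq V] {D : Digraph V} {a : ℕ} {X : Bool → Finset V}

omit [DecidableEq V] in
/-- By Hall's theorem, a digraph without a cycle factor has a set `S` on one side with fewer than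
`S.card` out-neighbours. -/
theorem exists_isCycleFactor_or_hall (hX : D.IsBipartition a X) :
    (∃ σ, D.IsCycleFactor σ) ∨ ∃ b, ∃ S U : Finset V, S ⊆ X b ∧ U ⊆ X (!b) ∧ U.card < S.card ∧
      ∀ s ∈ S, ∀ v, D.Adj s v → v ∈ U := by
  classical
  set N : V → Finset V := fun v => Finset.univ.filter fun u => D.Adj v u with hN
  have hNm : ∀ {v u}, u ∈ N v ↔ D.Adj v u := by simp [hN]
  by_cases h : ∀ S : Finset V, S.card ≤ (S.biUnion N).card
  · left
    obtain ⟨f, hf, hfN⟩ := (Finset.all_card_le_biUnion_card_iff_exists_injective N).mp h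
    exact ⟨Equiv.ofBijective f (Finite.injective_iff_bijective.mp hf), fun v => hNm.mp (hfN v)⟩
  right
  push Not at h
  obtain ⟨S, hS⟩ := h
  have hsub : ∀ b, (S ∩ X b).biUnion N ⊆ X (!b) := fun b v hv => by
    obtain ⟨s, hs, hsv⟩ := Finset.mem_biUnion.mp hv
    exact hX.adj _ _ _ (hNm.mp hsv) (Finset.mem_inter.mp hs).2
  have key : ∃ b, ((S ∩ X b).biUnion N).card < (S ∩ X b).card := by
    by_contra! hk
    have h1 : (S ∩ X true) ∪ (S ∩ X false) = S := by
      rw [← Finset.inter_union_distrib_left]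
      refine Finset.inter_eq_left.mpr fun v _ => Finset.mem_union.mpr (hX.cover true v)
    have h2 : S.card ≤ (S ∩ X true).card + (S ∩ X false).card := by
      conv_lhs => rw [← h1]
      exact Finset.card_union_le _ _
    have h3 : ((S ∩ X true).biUnion N).card + ((S ∩ X false).biUnion N).card ≤
        (S.biUnion N).card := by
      rw [← Finset.card_union_of_disjoint]
      · exact Finset.card_le_card (Finset.union_subset
          (Finset.biUnion_subset_biUnion_of_subset_left _ Finset.inter_subset_left)
          (Finset.biUnion_subset_biUnion_of_subset_left _ Finset.inter_subset_left))
      · exact Finset.disjoint_left.mpr fun v h3 h4 =>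
          hX.disj true v (hsub false h4) (hsub true h3)
    have := hk true
    have := hk false
    omega
  obtain ⟨b, hb⟩ := key
  exact ⟨b, S ∩ X b, (S ∩ X b).biUnion N, Finset.inter_subset_right, hsub b, hb, fun s hs v hv =>
    Finset.mem_biUnion.mpr ⟨s, hs, hNm.mpr hv⟩⟩

/-- In a digraph without a cycle factor, let `S` violate Hall's condition, let `U` contain its
out-neighbours, and let `R` and `W` be the remaining vertices of the two sides. The vertices of `S`
have few out-neighbours and those of `W` few in-neighbours, so the degree condition determines all
the sizes and forces all the arcs which are possible at `S` and at `W`. -/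
theorem exists_isCycleFactor_or_mem_familyH1 (hX : D.IsBipartition a X)
    (hM : D.SideCondition a X) (hs : D.IsStrong) (ha : 3 ≤ a) :
    (∃ σ, D.IsCycleFactor σ) ∨ D ∈ familyH1 V a := by
  rcases hX.exists_isCycleFactor_or_hall with h | ⟨b, S, U, hSX, hUX, hUS, hSU⟩
  · exact Or.inl h
  right
  set R := X b \ S with hR
  set W := X (!b) \ U with hW
  have hdisj := hX.disj b
  have hRm : ∀ {v}, v ∈ R ↔ v ∈ X b ∧ v ∉ S := by simp [hR]
  have hWm : ∀ {v}, v ∈ W ↔ v ∈ X (!b) ∧ v ∉ U := by simp [hW]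
  have hRc : R.card + S.card = a := by
    rw [hR, Finset.card_sdiff_add_card_eq_card hSX, hX.card]
  have hWc : W.card + U.card = a := by
    rw [hW, Finset.card_sdiff_add_card_eq_card hUX, hX.card]
  have hRX : R ⊆ X b := Finset.sdiff_subset
  have hWX : W ⊆ X (!b) := Finset.sdiff_subset
  have hSd : ∀ s ∈ S, (D.degree s : ℤ) ≤ a + U.card ∧ ((a + U.card : ℤ) ≤ D.degree s →
      (∀ u ∈ U, D.arc s u = 1) ∧ ∀ u ∈ X (!b), D.arc u s = 1) := by
    intro s hs
    have := sum_add_le_card_add_card (f := fun u => D.arc s u) (g := fun u => D.arc u s) hUX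
      (fun u => D.arc_le_one _ _) (fun u => D.arc_le_one _ _)
      fun u _ hu => arc_of_not_adj fun h => hu (hSU s hs u h)
    rwa [hX.card, ← hX.degree_eq (hSX hs)] at this
  have hWd : ∀ w ∈ W, (D.degree w : ℤ) ≤ a + R.card ∧ ((a + R.card : ℤ) ≤ D.degree w →
      (∀ v ∈ R, D.arc v w = 1) ∧ ∀ v ∈ X b, D.arc w v = 1) := by
    intro w hw
    have := sum_add_le_card_add_card (f := fun u => D.arc u w) (g := fun u => D.arc w u) hRX
      (fun u => D.arc_le_one _ _) (fun u => D.arc_le_one _ _)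
      fun u hu huR => arc_of_not_adj fun h => (hWm.mp hw).2
        (hSU u (by by_contra h; exact huR (hRm.mpr ⟨hu, h⟩)) w h)
    have h2 := hX.degree_eq (hWX hw)
    rw [Bool.not_not] at h2
    simp only [add_comm (D.arc _ w) (D.arc w _)] at this
    rwa [hX.card, ← h2] at this
  have hneb : ∀ {v t}, v ∈ X b → t ∈ X (!b) → v ≠ t := fun hv ht h => hdisj _ hv (h ▸ ht)
  have hS2 : 2 ≤ S.card := by
    by_contra hlt
    have hU0 : U = ∅ := Finset.card_eq_zero.mp (by omega)
    obtain ⟨s, hsS⟩ := Finset.card_pos.mp (show 0 < S.card by omega)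
    obtain ⟨t, ht⟩ := Finset.card_pos.mp (show 0 < (X (!b)).card by rw [hX.card]; omega)
    obtain ⟨u, v, rfl, -, huv⟩ := hs.exists_adj (Q := fun v => v = s) rfl
      (hneb (hSX hsS) ht).symm
    have := hSU u hsS v huv
    simp [hU0] at this
  have hW2 : 2 ≤ W.card := by
    by_contra hlt
    have hR0 : R = ∅ := Finset.card_eq_zero.mp (by omega)
    obtain ⟨w, hw⟩ := Finset.card_pos.mp (show 0 < W.card by omega)
    obtain ⟨t, ht⟩ := Finset.card_pos.mp (show 0 < S.card by omega)
    obtain ⟨u, v, -, hv, huv⟩ := hs.exists_adj (Q := fun v => v ≠ w) (x := t) (y := w)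
      (hneb (hSX ht) (hWX hw)) (by simp)
    obtain rfl := not_not.mp hv
    have h1 : u ∈ X b := by simpa using hX.adj' huv (hWX hw)
    have h2 : u ∈ S := by
      by_contra h
      have := hRm.mpr ⟨h1, h⟩
      simp [hR0] at this
    exact (hWm.mp hw).2 (hSU u h2 v huv)
  have hSs : ∀ s ∈ S, 3 * (a : ℤ) - 1 ≤ D.degree s + (a + U.card) := by
    intro s hsS
    obtain ⟨t, ht, hts⟩ := Finset.exists_mem_ne (show 1 < S.card by omega) s
    have := hM b s (hSX hsS) t (hSX ht) hts.symm
    have := (hSd t ht).1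
    omega
  have hWw : ∀ w ∈ W, 3 * (a : ℤ) - 1 ≤ D.degree w + (a + R.card) := by
    intro w hw
    obtain ⟨t, ht, htw⟩ := Finset.exists_mem_ne (show 1 < W.card by omega) w
    have := hM (!b) w (hWX hw) t (hWX ht) htw.symm
    have := (hWd t ht).1
    omega
  obtain ⟨s₀, hs₀⟩ := Finset.card_pos.mp (show 0 < S.card by omega)
  obtain ⟨w₀, hw₀⟩ := Finset.card_pos.mp (show 0 < W.card by omega)
  have hs₁ := hSs s₀ hs₀
  have hs₂ := (hSd s₀ hs₀).1
  have hw₁ := hWw w₀ hw₀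
  have hw₂ := (hWd w₀ hw₀).1
  have hUR : a = 2 * U.card + 1 ∧ a = 2 * R.card + 1 := by omega
  have hSf : ∀ s ∈ S, (∀ u ∈ U, D.Adj s u) ∧ ∀ u ∈ X (!b), D.Adj u s := by
    intro s hsS
    have := (hSd s hsS).2 (by have := hSs s hsS; omega)
    simpa only [arc_eq_one_iff] using this
  have hWf : ∀ w ∈ W, (∀ v ∈ R, D.Adj v w) ∧ ∀ v ∈ X b, D.Adj w v := by
    intro w hw
    have := (hWd w hw).2 (by have := hWw w hw; omega)
    simpa only [arc_eq_one_iff] using this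
  have hdeg : ∀ {c v} {P Q : Finset V}, v ∈ X c → P ⊆ X (!c) → Q = X (!c) \ P →
      (D.degree v : ℤ) ≤ 2 * Q.card + D.degreeIn P v := by
    intro c v P Q hv hP hQ
    rw [hX.degree_eq hv, ← Finset.sum_sdiff hP, ← D.degreeIn_eq_sum P, ← hQ]
    have : ∑ u ∈ Q, (D.arc v u + D.arc u v) ≤ ∑ u ∈ Q, (2 : ℤ) :=
      Finset.sum_le_sum fun u _ => by
        have := D.arc_le_one v u
        have := D.arc_le_one u v
        omega
    simp only [Finset.sum_const, nsmul_eq_mul] at this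
    linarith
  refine ⟨S, R, U, W, ?_⟩
  have hdj : ∀ {P Q : Finset V}, P ⊆ X b → Q ⊆ X (!b) → Disjoint P Q := fun hP hQ =>
    Finset.disjoint_left.mpr fun v h1 h2 => hdisj v (hP h1) (hQ h2)
  exact {
    odd := ⟨_, hUR.1⟩
    three_le := ha
    disjoint_SR := Finset.disjoint_sdiff
    disjoint_SU := hdj hSX hUX
    disjoint_SW := hdj hSX hWX
    disjoint_RU := hdj hRX hUX
    disjoint_RW := hdj hRX hWX
    disjoint_UW := Finset.disjoint_sdiff
    cover := fun v => by
      have := hX.cover b v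
      rw [hRm, hWm]
      tauto
    card_S := by omega
    card_W := by omega
    card_U := by omega
    card_R := by omega
    arcs_RW := fun r hr w hw => ⟨(hWf w hw).1 r hr, (hWf w hw).2 r (hRX hr)⟩
    arcs_US := fun u hu s hs => ⟨(hSf s hs).2 u (hUX hu), (hSf s hs).1 u hu⟩
    arcs_WS := fun w hw s hs => (hSf s hs).2 w (hWX hw)
    arc_UR := by
      obtain ⟨u, v, hu, hv, huv⟩ := hs.exists_adj (Q := fun v => v ∈ S ∨ v ∈ U) (Or.inl hs₀)
        (y := w₀) (by rintro (h | h); exacts [hneb (hSX h) (hWX hw₀) rfl, (hWm.mp hw₀).2 h])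
      rw [not_or] at hv
      have huU := hu.resolve_left fun h => hv.2 (hSU u h v huv)
      exact ⟨v, hRm.mpr ⟨by simpa using hX.adj _ _ _ huv (hUX huU), hv.1⟩, u, huU, huv⟩
    degree_R := fun r hr => by
      have h1 := hdeg (hRX hr) hUX hW
      have h2 := hM b r (hRX hr) s₀ (hSX hs₀) fun h => (hRm.mp hr).2 (h ▸ hs₀)
      omega
    degree_U := fun u hu => by
      have h1 := hdeg (P := R) (Q := S) (hUX hu) (by rwa [Bool.not_not])
        (by rw [Bool.not_not, hR, Finset.sdiff_sdiff_eq_self hSX])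
      have h2 := hM (!b) u (hUX hu) w₀ (hWX hw₀) fun h => (hWm.mp hw₀).2 (h ▸ hu)
      omega
    arcs_only := fun x y hxy => by
      rcases hX.cover b x with hx | hx
      · have hy := hX.adj _ _ _ hxy hx
        by_cases hxS : x ∈ S
        · exact Or.inr (Or.inr (Or.inr (Or.inl ⟨hxS, hSU x hxS y hxy⟩)))
        by_cases hyU : y ∈ U
        · exact Or.inr (Or.inr (Or.inr (Or.inr (Or.inr (Or.inr ⟨hRm.mpr ⟨hx, hxS⟩, hyU⟩)))))
        · exact Or.inl ⟨hRm.mpr ⟨hx, hxS⟩, hWm.mpr ⟨hy, hyU⟩⟩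
      · have hy : y ∈ X b := by simpa using hX.adj _ _ _ hxy hx
        by_cases hxU : x ∈ U
        · by_cases hyS : y ∈ S
          · exact Or.inr (Or.inr (Or.inl ⟨hxU, hyS⟩))
          · exact Or.inr (Or.inr (Or.inr (Or.inr (Or.inr (Or.inl ⟨hxU, hRm.mpr ⟨hy, hyS⟩⟩)))))
        · by_cases hyS : y ∈ S
          · exact Or.inr (Or.inr (Or.inr (Or.inr (Or.inl ⟨hWm.mpr ⟨hx, hxU⟩, hyS⟩))))
          · exact Or.inr (Or.inl ⟨hWm.mpr ⟨hx, hxU⟩, hRm.mpr ⟨hy, hyS⟩⟩) }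

end IsBipartition

/-! ### Invariance under isomorphism -/

theorem IsStrong.of_relIso {V W : Type*} {D : Digraph V} {H : Digraph W} (e : D.Adj ≃r H.Adj)
    (h : D.IsStrong) : H.IsStrong := by
  intro x y
  have h1 : Relation.ReflTransGen H.Adj (e (e.symm x)) (e (e.symm y)) :=
    (h (e.symm x) (e.symm y)).lift (p := H.Adj) e fun a b => e.map_rel_iff.mpr
  rwa [e.apply_symm_apply, e.apply_symm_apply] at h1

theorem degree_relIso {V W : Type*} [Fintype V] [Fintype W] {D : Digraph V} {H : Digraph W}
    (e : D.Adj ≃r H.Adj) (v : V) : H.degree (e v) = D.degree v := by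
  classical
  have key : (H.degree (e v) : ℤ) = D.degree v := by
    rw [degree_eq_sum, degree_eq_sum]
    refine (Fintype.sum_equiv e.toEquiv _ _ fun u => ?_).symm
    have h : ∀ u v, H.arc (e u) (e v) = D.arc u v := fun u v => by simp [arc, e.map_rel_iff]
    exact congrArg₂ _ (h v u).symm (h u v).symm
  exact_mod_cast key

theorem ConditionM.of_relIso {V W : Type*} [Fintype V] [Fintype W] {D : Digraph V}
    {H : Digraph W} (e : D.Adj ≃r H.Adj) {a : ℕ} {k : ℤ} (h : D.ConditionM a k) :
    H.ConditionM a k := by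
  intro u v huv h1 h2
  obtain ⟨u, rfl⟩ := e.surjective u
  obtain ⟨v, rfl⟩ := e.surjective v
  rw [degree_relIso, degree_relIso]
  rw [e.map_rel_iff] at h1 h2
  exact h u v (fun h => huv (h ▸ rfl)) h1 h2

theorem IsHamiltonian.of_relIso {V W : Type*} {D : Digraph V} {H : Digraph W}
    (e : D.Adj ≃r H.Adj) (h : D.IsHamiltonian) : H.IsHamiltonian := by
  obtain ⟨n, hn, c, hc, hadj⟩ := h
  exact ⟨n, hn, e ∘ c, e.bijective.comp hc, fun i => e.map_rel_iff.mpr (hadj i)⟩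

/-! ### Digraphs of order six -/

/-- The bipartite digraph with `3 + 3` vertices and given matrices of arcs: `P i j` tells whether
the `i`-th vertex on the left dominates the `j`-th vertex on the right, and `Q j i` whether the
`j`-th vertex on the right dominates the `i`-th vertex on the left. -/
def ofMatrices (P Q : Fin 3 → Fin 3 → Bool) : Digraph (Fin 3 ⊕ Fin 3) where
  Adj
    | Sum.inl i, Sum.inr j => P i j = true
    | Sum.inr j, Sum.inl i => Q j i = true
    | _, _ => False

instance (P Q : Fin 3 → Fin 3 → Bool) : DecidableRel (ofMatrices P Q).Adj
  | Sum.inl i, Sum.inr j => inferInstanceAs (Decidable (P i j = true))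
  | Sum.inr j, Sum.inl i => inferInstanceAs (Decidable (Q j i = true))
  | Sum.inl _, Sum.inl _ => inferInstanceAs (Decidable False)
  | Sum.inr _, Sum.inr _ => inferInstanceAs (Decidable False)

theorem digraphH2_eq_ofMatrices : digraphH2 =
    ofMatrices ![![true, true, false], ![false, true, true], ![true, false, true]]
      ![![true, false, true], ![false, true, true], ![true, true, false]] := by
  ext u v
  rcases u with u | u <;> rcases v with v | v <;> fin_cases u <;> fin_cases v <;>
    simp [digraphH2, ofMatrices]

/-- The degree of the `i`-th vertex on the left of `ofMatrices P Q`, and thus also of the `i`-th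
vertex on the right of `ofMatrices Q P`. -/
def matrixDegree (P Q : Fin 3 → Fin 3 → Bool) (i : Fin 3) : ℕ :=
  (P i 0).toNat + (P i 1).toNat + (P i 2).toNat + ((Q 0 i).toNat + (Q 1 i).toNat + (Q 2 i).toNat)

theorem arc_ofMatrices (P Q : Fin 3 → Fin 3 → Bool) (i j : Fin 3) :
    (ofMatrices P Q).arc (Sum.inl i) (Sum.inr j) = (P i j).toNat ∧
    (ofMatrices P Q).arc (Sum.inr j) (Sum.inl i) = (Q j i).toNat ∧
    (ofMatrices P Q).arc (Sum.inl i) (Sum.inl j) = 0 ∧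
    (ofMatrices P Q).arc (Sum.inr i) (Sum.inr j) = 0 := by
  refine ⟨?_, ?_, by simp [arc, ofMatrices], by simp [arc, ofMatrices]⟩
  · cases h : P i j <;> simp [arc, ofMatrices, h]
  · cases h : Q j i <;> simp [arc, ofMatrices, h]

theorem degree_ofMatrices_inl (P Q : Fin 3 → Fin 3 → Bool) (i : Fin 3) :
    (ofMatrices P Q).degree (Sum.inl i) = matrixDegree P Q i := by
  have h := degree_eq_sum (ofMatrices P Q) (Sum.inl i)
  simp only [Fintype.sum_sum_type, Fin.sum_univ_three, arc_ofMatrices] at h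
  unfold matrixDegree
  omega

theorem degree_ofMatrices_inr (P Q : Fin 3 → Fin 3 → Bool) (i : Fin 3) :
    (ofMatrices P Q).degree (Sum.inr i) = matrixDegree Q P i := by
  have h := degree_eq_sum (ofMatrices P Q) (Sum.inr i)
  simp only [Fintype.sum_sum_type, Fin.sum_univ_three, arc_ofMatrices] at h
  unfold matrixDegree
  omega

/-- The degree condition for pairs of vertices of `ofMatrices P Q` on the same side. -/
def MatrixSideCondition (P Q : Fin 3 → Fin 3 → Bool) : Prop :=
  ∀ i j, i < j → 8 ≤ matrixDegree P Q i + matrixDegree P Q j ∧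
    8 ≤ matrixDegree Q P i + matrixDegree Q P j

instance (P Q : Fin 3 → Fin 3 → Bool) : Decidable (MatrixSideCondition P Q) := by
  unfold MatrixSideCondition; infer_instance

/-- The degree condition for pairs of vertices of `ofMatrices P Q` on different sides. -/
def MatrixCrossCondition (P Q : Fin 3 → Fin 3 → Bool) : Prop :=
  ∀ i j, P i j = false → Q j i = false → 8 ≤ matrixDegree P Q i + matrixDegree Q P j

instance (P Q : Fin 3 → Fin 3 → Bool) : Decidable (MatrixCrossCondition P Q) := by
  unfold MatrixCrossCondition; infer_instance

/-- `ofMatrices P Q` has no hamiltonian cycle. Such a cycle, started at the left vertex `0`, visits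
the left vertices in the order `0, i, -i` and the right vertices in some order `j, k, l`. -/
def MatrixNonHamiltonian (P Q : Fin 3 → Fin 3 → Bool) : Prop :=
  ∀ i j, i ≠ 0 → P 0 j = true → Q j i = true → ∀ k, k ≠ j → P i k = true → Q k (-i) = true →
    ∀ l, l ≠ j → l ≠ k → P (-i) l = true → Q l 0 = false

set_option synthInstance.maxSize 2000 in
instance (P Q : Fin 3 → Fin 3 → Bool) : Decidable (MatrixNonHamiltonian P Q) := by
  unfold MatrixNonHamiltonian; infer_instance

theorem matrixConditions (P Q : Fin 3 → Fin 3 → Bool) (h : (ofMatrices P Q).ConditionM 3 (-1)) :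
    MatrixSideCondition P Q ∧ MatrixCrossCondition P Q := by
  refine ⟨fun i j hij => ⟨?_, ?_⟩, fun i j h1 h2 => ?_⟩
  · have := h (Sum.inl i) (Sum.inl j) (by simpa using hij.ne) id id
    rw [degree_ofMatrices_inl, degree_ofMatrices_inl] at this
    omega
  · have := h (Sum.inr i) (Sum.inr j) (by simpa using hij.ne) id id
    rw [degree_ofMatrices_inr, degree_ofMatrices_inr] at this
    omega
  · have := h (Sum.inl i) (Sum.inr j) (by simp) (by simp [ofMatrices, h1])
      (by simp [ofMatrices, h2])
    rw [degree_ofMatrices_inl, degree_ofMatrices_inr] at this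
    omega

theorem injective_sixCycle : ∀ i j k l : Fin 3, i ≠ 0 → k ≠ j → l ≠ j → l ≠ k →
    Function.Injective (![Sum.inl 0, Sum.inr j, Sum.inl i, Sum.inr k, Sum.inl (-i), Sum.inr l] :
      Fin 6 → Fin 3 ⊕ Fin 3) := by
  decide

theorem matrixNonHamiltonian (P Q : Fin 3 → Fin 3 → Bool) (h : ¬ (ofMatrices P Q).IsHamiltonian) :
    MatrixNonHamiltonian P Q := by
  intro i j hi h1 h2 k hk h3 h4 l hlj hlk h5
  by_contra h6
  refine h ⟨6, by norm_num, (![Sum.inl 0, Sum.inr j, Sum.inl i, Sum.inr k, Sum.inl (-i),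
    Sum.inr l] : Fin 6 → Fin 3 ⊕ Fin 3), ?_, ?_⟩
  · exact (Fintype.bijective_iff_injective_and_card _).mpr
      ⟨injective_sixCycle i j k l hi hk hlj hlk, rfl⟩
  · change ∀ t : Fin 6, _
    intro t
    fin_cases t
    exacts [h1, h2, h3, h4, h5, show Q l 0 = true by simpa using h6]

theorem matrix_eq (P : Fin 3 → Fin 3 → Bool) :
    P = ![![P 0 0, P 0 1, P 0 2], ![P 1 0, P 1 1, P 1 2], ![P 2 0, P 2 1, P 2 2]] := by
  ext i j
  fin_cases i <;> fin_cases j <;> rfl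

set_option synthInstance.maxHeartbeats 200000 in
set_option synthInstance.maxSize 2000 in
/-- Three 2-cycles no two of which can be merged: some 2-cycle has no leaving arcs, or no entering
arcs. -/
theorem three_two_cycles_bits : ∀ p01 p10 : Bool, (p01 && p10) = false →
    ∀ p02 p20 : Bool, (p02 && p20) = false → ∀ p12 p21 : Bool, (p12 && p21) = false →
    ∀ q01 q10 : Bool, (q01 && q10) = false → ∀ q02 q20 : Bool, (q02 && q20) = false →
    ∀ q12 q21 : Bool, (q12 && q21) = false →
    MatrixSideCondition ![![true, p01, p02], ![p10, true, p12], ![p20, p21, true]]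
      ![![true, q01, q02], ![q10, true, q12], ![q20, q21, true]] →
    MatrixNonHamiltonian ![![true, p01, p02], ![p10, true, p12], ![p20, p21, true]]
      ![![true, q01, q02], ![q10, true, q12], ![q20, q21, true]] →
    ∃ i, (∀ j, j ≠ i → ![![true, p01, p02], ![p10, true, p12], ![p20, p21, true]] i j = false ∧
      ![![true, q01, q02], ![q10, true, q12], ![q20, q21, true]] i j = false) ∨
      ∀ j, j ≠ i → ![![true, p01, p02], ![p10, true, p12], ![p20, p21, true]] j i = false ∧
      ![![true, q01, q02], ![q10, true, q12], ![q20, q21, true]] j i = false := by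
  decide +kernel

set_option synthInstance.maxHeartbeats 200000 in
set_option synthInstance.maxSize 2000 in
/-- A 2-cycle and a 4-cycle which cannot be merged: there are four possibilities. -/
theorem two_cycle_four_cycle_bits : ∀ p01 p10 : Bool, (p01 && p10) = false →
    ∀ p02 p20 : Bool, (p02 && p20) = false → ∀ q01 q20 : Bool, (q01 && q20) = false →
    ∀ q02 q10 : Bool, (q02 && q10) = false → (p01 || p02 || q01 || q02) = true →
    (p10 || p20 || q10 || q20) = true → ∀ p12 p21 q11 q22 : Bool,
    MatrixSideCondition ![![true, p01, p02], ![p10, true, p12], ![p20, p21, true]]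
      ![![true, q01, q02], ![q10, q11, true], ![q20, true, q22]] →
    MatrixCrossCondition ![![true, p01, p02], ![p10, true, p12], ![p20, p21, true]]
      ![![true, q01, q02], ![q10, q11, true], ![q20, true, q22]] →
    MatrixNonHamiltonian ![![true, p01, p02], ![p10, true, p12], ![p20, p21, true]]
      ![![true, q01, q02], ![q10, q11, true], ![q20, true, q22]] →
    ((p01, p02, p10, p12, p20, p21) = (false, true, true, false, false, true) ∨
      (p01, p02, p10, p12, p20, p21) = (true, false, false, true, true, false)) ∧
    ((q01, q02, q10, q11, q20, q22) = (false, true, false, true, true, false) ∨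
      (q01, q02, q10, q11, q20, q22) = (true, false, true, false, false, true)) := by
  decide +kernel

/-- The four possibilities for a 2-cycle and a 4-cycle are isomorphic to `digraphH2`. -/
theorem isIsomorphic_digraphH2 {P Q : Fin 3 → Fin 3 → Bool}
    (hP : P = ![![true, false, true], ![true, true, false], ![false, true, true]] ∨
      P = ![![true, true, false], ![false, true, true], ![true, false, true]])
    (hQ : Q = ![![true, false, true], ![false, true, true], ![true, true, false]] ∨
      Q = ![![true, true, false], ![true, false, true], ![false, true, true]]) :
    (ofMatrices P Q).IsIsomorphic digraphH2 := by
  rw [digraphH2_eq_ofMatrices]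
  have key : ∀ {P Q P' Q' : Fin 3 → Fin 3 → Bool} (f g : Fin 3 → Fin 3),
      Function.Bijective (Sum.map f g) →
      (∀ u v, (ofMatrices P' Q').Adj (Sum.map f g u) (Sum.map f g v) ↔ (ofMatrices P Q).Adj u v) →
      (ofMatrices P Q).IsIsomorphic (ofMatrices P' Q') := fun f g hfg h =>
    ⟨⟨Equiv.ofBijective _ hfg, fun {u v} => h u v⟩⟩
  rcases hP with rfl | rfl <;> rcases hQ with rfl | rfl
  · exact key ![1, 0, 2] ![1, 0, 2] (by decide) (by decide)
  · exact key ![0, 2, 1] ![0, 2, 1] (by decide) (by decide)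
  · exact key ![0, 1, 2] ![0, 1, 2] (by decide) (by decide)
  · exact key ![1, 0, 2] ![2, 1, 0] (by decide) (by decide)

/-- The matrices of the arcs between two enumerated sides. -/
theorem nonempty_relIso_ofMatrices {V : Type*} {D : Digraph V} {a : ℕ} {X : Bool → Finset V}
    (hX : D.IsBipartition a X) {x y : Fin 3 → V} (hx : ∀ i, x i ∈ X true) (hy : ∀ i, y i ∈ X false)
    (h : Function.Bijective (Sum.elim x y)) {P Q : Fin 3 → Fin 3 → Bool}
    (hP : ∀ i j, P i j = true ↔ D.Adj (x i) (y j)) (hQ : ∀ i j, Q i j = true ↔ D.Adj (y i) (x j)) :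
    Nonempty (D.Adj ≃r (ofMatrices P Q).Adj) := by
  refine ⟨(⟨Equiv.ofBijective _ h, fun {u v} => ?_⟩ : (ofMatrices P Q).Adj ≃r D.Adj).symm⟩
  rcases u with i | i <;> rcases v with j | j
  · exact iff_of_false (hX.not_adj (hx i) (hx j)) id
  · exact (hP i j).symm
  · exact (hQ i j).symm
  · exact iff_of_false (hX.not_adj (hy i) (hy j)) id

/-- The cycle types of a permutation of three elements. -/
theorem exists_cycle_type : ∀ f : Fin 3 → Fin 3, Function.Injective f →
    ∃ τ : Fin 3 → Fin 3, Function.Injective τ ∧ ((∀ i, f (τ i) = τ i) ∨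
      (f (τ 0) = τ 0 ∧ f (τ 1) = τ 2 ∧ f (τ 2) = τ 1) ∨
      (f (τ 0) = τ 1 ∧ f (τ 1) = τ 2 ∧ f (τ 2) = τ 0)) := by
  decide

namespace IsBipartition

variable {V : Type*} [Fintype V] {D : Digraph V} {X : Bool → Finset V}

/-- The vertices of one side, enumerated according to the cycles of `σ`. -/
theorem exists_enumeration (hX : D.IsBipartition 3 X) {σ : Perm V} (hσ : D.IsCycleFactor σ) :
    ∃ x : Fin 3 → V, (∀ i, x i ∈ X true) ∧ (∀ i, σ (x i) ∈ X false) ∧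
      Function.Bijective (Sum.elim x fun i => σ (x i)) ∧ ((∀ i, σ (σ (x i)) = x i) ∨
      (σ (σ (x 0)) = x 0 ∧ σ (σ (x 1)) = x 2 ∧ σ (σ (x 2)) = x 1) ∨
      (σ (σ (x 0)) = x 1 ∧ σ (σ (x 1)) = x 2 ∧ σ (σ (x 2)) = x 0)) := by
  have e := (X true).equivFinOfCardEq (hX.card true)
  have h1 : ∀ i, σ (e.symm i) ∈ X false := fun i => hX.adj _ _ _ (hσ _) (e.symm i).2
  have h2 : ∀ i, σ (σ (e.symm i)) ∈ X true := fun i => hX.adj _ _ _ (hσ _) (h1 i)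
  obtain ⟨τ, hτ, h3⟩ := exists_cycle_type (fun i => e ⟨_, h2 i⟩) fun i j hij => by
    have := congrArg Subtype.val (e.injective hij)
    exact e.symm.injective (Subtype.ext (σ.injective (σ.injective this)))
  have h4 : ∀ i j, e ⟨_, h2 i⟩ = j → σ (σ (e.symm i)) = e.symm j := by
    rintro i j rfl; simp
  have hx : Function.Injective fun i => ((e.symm (τ i) : X true) : V) :=
    Subtype.val_injective.comp (e.symm.injective.comp hτ)
  refine ⟨fun i => e.symm (τ i), fun i => (e.symm (τ i)).2, fun i => h1 _, ?_, ?_⟩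
  · refine (Fintype.bijective_iff_injective_and_card _).mpr ⟨?_, by rw [hX.card_eq]; rfl⟩
    refine hx.sumElim (σ.injective.comp hx) fun i j h => ?_
    exact hX.disj true _ (e.symm (τ i)).2 (h ▸ h1 _)
  · refine h3.imp (fun h i => h4 _ _ (h i)) (Or.imp ?_ ?_)
    · exact fun h => ⟨h4 _ _ h.1, h4 _ _ h.2.1, h4 _ _ h.2.2⟩
    · exact fun h => ⟨h4 _ _ h.1, h4 _ _ h.2.1, h4 _ _ h.2.2⟩

/-- The cycles of a factor which admits no merging are three 2-cycles, a 2-cycle and a 4-cycle, or a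
hamiltonian cycle. -/
theorem isHamiltonian_or_isIsomorphic_digraphH2 (hX : D.IsBipartition 3 X)
    (hM : D.ConditionM 3 (-1)) (hs : D.IsStrong) {σ : Perm V} (hσ : D.IsCycleFactor σ) :
    D.IsHamiltonian ∨ D.IsIsomorphic digraphH2 := by
  classical
  by_cases hH : D.IsHamiltonian
  · exact Or.inl hH
  right
  obtain ⟨σ, hσ⟩ := hσ.exists_isMaxCycleFactor
  obtain ⟨x, hx, hy, hxy, hcyc⟩ := hX.exists_enumeration hσ.1
  obtain ⟨P, hP⟩ : ∃ P : Fin 3 → Fin 3 → Bool, ∀ i j, P i j = true ↔ D.Adj (x i) (σ (x j)) :=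
    ⟨fun i j => decide (D.Adj (x i) (σ (x j))), by simp⟩
  obtain ⟨Q, hQ⟩ : ∃ Q : Fin 3 → Fin 3 → Bool, ∀ i j, Q i j = true ↔ D.Adj (σ (x i)) (x j) :=
    ⟨fun i j => decide (D.Adj (σ (x i)) (x j)), by simp⟩
  obtain ⟨e⟩ := nonempty_relIso_ofMatrices hX hx hy hxy hP hQ
  obtain ⟨hc1, hc2⟩ := matrixConditions P Q (hM.of_relIso e)
  have hc3 := matrixNonHamiltonian P Q fun h => hH (h.of_relIso e.symm)
  have hs' := hs.of_relIso e
  have hPd : ∀ i, P i i = true := fun i => (hP i i).mpr (hσ.1 _)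
  have hx' : Function.Injective x := fun i j h => by
    simpa using hxy.1 (a₁ := Sum.inl i) (a₂ := Sum.inl j) h
  have hxσ : ∀ i j, x i ≠ σ (x j) := fun i j h => by
    simpa using hxy.1 (a₁ := Sum.inl i) (a₂ := Sum.inr j) h
  have hnP : ∀ i j, ¬ σ.SameCycle (x i) (x j) → (P i j && P j i) = false := by
    intro i j h
    have := hσ.not_adj h
    rw [← hP, ← hP] at this
    simpa using this
  have hnQ : ∀ i j k l, x k = σ (σ (x i)) → x l = σ (σ (x j)) →
      ¬ σ.SameCycle (x i) (x j) → (Q i l && Q j k) = false := by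
    intro i j k l hk hl h
    have := hσ.not_adj (x := σ (x i)) (y := σ (x j)) (by simpa using h)
    rw [← hk, ← hl, ← hQ, ← hQ] at this
    simpa using this
  -- No set of indices is closed under out-neighbours, or under in-neighbours.
  have hcut : ∀ p : Fin 3 → Prop, (∃ i, p i) → (∃ i, ¬ p i) →
      ∃ i j, p i ∧ ¬ p j ∧ (P i j = true ∨ Q i j = true) := by
    rintro p ⟨i, hi⟩ ⟨j, hj⟩
    obtain ⟨u, v, hu, hv, huv⟩ := hs'.exists_adj (Q := Sum.elim p p) (x := Sum.inl i)
      (y := Sum.inl j) hi hj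
    rcases u with u | u <;> rcases v with v | v
    · exact huv.elim
    · exact ⟨u, v, hu, hv, Or.inl huv⟩
    · exact ⟨u, v, hu, hv, Or.inr huv⟩
    · exact huv.elim
  rcases hcyc with hcyc | ⟨h0, h1, h2⟩ | ⟨h0, h1, h2⟩
  · have hQd : ∀ i, Q i i = true := fun i => (hQ i i).mpr (by
      have := hσ.1 (σ (x i)); rwa [hcyc] at this)
    have hne : ∀ i j, i ≠ j → ¬ σ.SameCycle (x i) (x j) := by
      intro i j hij h
      have := SameCycle.induction (Q := fun u => u = x i ∨ u = σ (x i))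
        (by rintro _ (rfl | rfl)
            · exact Or.inr rfl
            · exact Or.inl (hcyc i)) h (Or.inl rfl)
      exact this.elim (fun h => hij (hx' h).symm) (hxσ j i)
    have hnP' := fun i j hij => hnP i j (hne i j hij)
    have hnQ' := fun i j hij => hnQ i j i j (hcyc i).symm (hcyc j).symm (hne i j hij)
    rw [matrix_eq P, matrix_eq Q] at hc1 hc3
    simp only [hPd, hQd] at hc1 hc3
    have key := three_two_cycles_bits _ _ (hnP' 0 1 (by decide)) _ _ (hnP' 0 2 (by decide)) _ _
      (hnP' 1 2 (by decide)) _ _ (hnQ' 0 1 (by decide)) _ _ (hnQ' 0 2 (by decide)) _ _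
      (hnQ' 1 2 (by decide)) hc1 hc3
    have hPm := matrix_eq P
    have hQm := matrix_eq Q
    simp only [hPd, hQd] at hPm hQm
    rw [← hPm, ← hQm] at key
    exfalso
    obtain ⟨i, hi⟩ := key
    obtain ⟨k, hk⟩ := exists_ne i
    rcases hi with hi | hi
    · obtain ⟨s, t, rfl, ht, hst⟩ := hcut (fun j => j = i) ⟨i, rfl⟩ ⟨k, hk⟩
      simp [hi t ht] at hst
    · obtain ⟨s, t, hs1, ht, hst⟩ := hcut (fun j => j ≠ i) ⟨k, hk⟩ ⟨i, by simp⟩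
      obtain rfl := not_not.mp ht
      simp [hi s hs1] at hst
  · have hQ0 : Q 0 0 = true := (hQ _ _).mpr (by have := hσ.1 (σ (x 0)); rwa [h0] at this)
    have hQ1 : Q 1 2 = true := (hQ _ _).mpr (by have := hσ.1 (σ (x 1)); rwa [h1] at this)
    have hQ2 : Q 2 1 = true := (hQ _ _).mpr (by have := hσ.1 (σ (x 2)); rwa [h2] at this)
    have hne : ∀ j, 0 ≠ j → ¬ σ.SameCycle (x 0) (x j) := by
      intro j hij h
      have := SameCycle.induction (Q := fun u => u = x 0 ∨ u = σ (x 0))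
        (by rintro _ (rfl | rfl)
            · exact Or.inr rfl
            · exact Or.inl h0) h (Or.inl rfl)
      exact this.elim (fun h => hij (hx' h).symm) (hxσ j 0)
    have hn1 := hne 1 (by decide)
    have hn2 := hne 2 (by decide)
    have hout : (P 0 1 || P 0 2 || Q 0 1 || Q 0 2) = true := by
      obtain ⟨s, t, rfl, ht, hst⟩ := hcut (fun j => j = 0) ⟨0, rfl⟩ ⟨1, by decide⟩
      fin_cases t
      · exact absurd rfl ht
      · rcases hst with h | h <;> simp_all
      · rcases hst with h | h <;> simp_all
    have hin : (P 1 0 || P 2 0 || Q 1 0 || Q 2 0) = true := by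
      obtain ⟨s, t, hs1, ht, hst⟩ := hcut (fun j => j ≠ 0) ⟨1, by decide⟩ ⟨0, by decide⟩
      obtain rfl := not_not.mp ht
      fin_cases s
      · exact absurd rfl hs1
      · rcases hst with h | h <;> simp_all
      · rcases hst with h | h <;> simp_all
    rw [matrix_eq P, matrix_eq Q] at hc1 hc2 hc3
    simp only [hPd, hQ0, hQ1, hQ2] at hc1 hc2 hc3
    obtain ⟨key1, key2⟩ := two_cycle_four_cycle_bits _ _ (hnP 0 1 hn1) _ _ (hnP 0 2 hn2) _ _
      (hnQ 0 2 0 1 h0.symm h2.symm hn2) _ _ (hnQ 0 1 0 2 h0.symm h1.symm hn1) hout hin _ _ _ _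
      hc1 hc2 hc3
    obtain ⟨e'⟩ := isIsomorphic_digraphH2 (P := P) (Q := Q)
      (by rw [matrix_eq P]; simp only [Prod.mk.injEq] at key1
          refine key1.imp ?_ ?_ <;> rintro ⟨k1, k2, k3, k4, k5, k6⟩ <;>
            simp only [hPd, k1, k2, k3, k4, k5, k6])
      (by rw [matrix_eq Q]; simp only [Prod.mk.injEq] at key2
          refine key2.imp ?_ ?_ <;> rintro ⟨k1, k2, k3, k4, k5, k6⟩ <;>
            simp only [hQ0, hQ1, hQ2, k1, k2, k3, k4, k5, k6])
    exact ⟨e.trans e'⟩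
  · refine absurd (hσ.1.isHamiltonian (by rw [hX.card_eq]; norm_num) ?_) hH
    have hst : ∀ u, σ.SameCycle u (σ u) := fun u => ⟨1, rfl⟩
    have h01 : σ.SameCycle (x 0) (x 1) := h0 ▸ (hst _).trans (hst _)
    have h12 : σ.SameCycle (x 1) (x 2) := h1 ▸ (hst _).trans (hst _)
    have hall : ∀ u, σ.SameCycle (x 0) u := by
      intro u
      obtain ⟨i, rfl⟩ := hxy.2 u
      have hi : ∀ i, σ.SameCycle (x 0) (x i) := by
        intro i
        fin_cases i
        exacts [SameCycle.refl _ _, h01, h01.trans h12]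
      rcases i with i | i
      · exact hi i
      · exact (hi i).trans (hst _)
    exact fun u v => (hall u).symm.trans (hall v)

end IsBipartition

/-! ### The exceptional digraphs -/

theorem degreeIn_add_degreeIn_le {V : Type*} [Fintype V] (D : Digraph V) {P Q : Finset V}
    (h : Disjoint P Q) (v : V) : D.degreeIn P v + D.degreeIn Q v ≤ D.degree v := by
  classical
  have key : (D.degreeIn P v + D.degreeIn Q v : ℤ) ≤ D.degree v := by
    rw [degreeIn_eq_sum, degreeIn_eq_sum, degree_eq_sum, ← Finset.sum_union h]
    exact Finset.sum_le_sum_of_subset_of_nonneg (Finset.subset_univ _) fun u _ _ =>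
      add_nonneg (D.arc_nonneg _ _) (D.arc_nonneg _ _)
  exact_mod_cast key

theorem card_le_degreeIn {V : Type*} {D : Digraph V} {P : Finset V} {v : V}
    (h : ∀ u ∈ P, D.Adj u v) : P.card ≤ D.degreeIn P v := by
  classical
  unfold degreeIn
  rw [Finset.filter_true_of_mem (p := fun u => D.Adj u v) h]
  omega

theorem two_mul_card_le_degreeIn {V : Type*} {D : Digraph V} {P : Finset V} {v : V}
    (h : ∀ u ∈ P, D.Adj u v ∧ D.Adj v u) : 2 * P.card ≤ D.degreeIn P v := by
  classical
  unfold degreeIn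
  rw [Finset.filter_true_of_mem (p := fun u => D.Adj u v) fun u hu => (h u hu).1,
    Finset.filter_true_of_mem (p := fun u => D.Adj v u) fun u hu => (h u hu).2]
  omega

namespace IsH1With

variable {V : Type*} {H : Digraph V} {a : ℕ} {S R U W : Finset V}

theorem isStrong (h : H.IsH1With a S R U W) : H.IsStrong := by
  obtain ⟨r₀, hr₀, u₀, hu₀, hur⟩ := h.arc_UR
  have := h.three_le
  have := h.card_S
  have := h.card_W
  obtain ⟨s₀, hs₀⟩ := Finset.card_pos.mp (show 0 < S.card by omega)
  obtain ⟨w₀, hw₀⟩ := Finset.card_pos.mp (show 0 < W.card by omega)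
  have hfrom : ∀ v, Relation.ReflTransGen H.Adj u₀ v := by
    intro v
    have h1 : Relation.ReflTransGen H.Adj u₀ r₀ := .single hur
    rcases h.cover v with hv | hv | hv | hv
    · exact .single (h.arcs_US u₀ hu₀ v hv).1
    · exact (h1.tail (h.arcs_RW r₀ hr₀ w₀ hw₀).1).tail (h.arcs_RW v hv w₀ hw₀).2
    · exact (Relation.ReflTransGen.single (h.arcs_US u₀ hu₀ s₀ hs₀).1).tail
        (h.arcs_US v hv s₀ hs₀).2
    · exact h1.tail (h.arcs_RW r₀ hr₀ v hv).1
  have hto : ∀ v, Relation.ReflTransGen H.Adj v u₀ := by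
    intro v
    have h1 : Relation.ReflTransGen H.Adj s₀ u₀ := .single (h.arcs_US u₀ hu₀ s₀ hs₀).2
    rcases h.cover v with hv | hv | hv | hv
    · exact .single (h.arcs_US u₀ hu₀ v hv).2
    · exact (h1.head (h.arcs_WS w₀ hw₀ s₀ hs₀)).head (h.arcs_RW v hv w₀ hw₀).1
    · exact h1.head (h.arcs_US v hv s₀ hs₀).1
    · exact h1.head (h.arcs_WS v hv s₀ hs₀)
  exact fun x y => (hto x).trans (hfrom y)

theorem le_two_mul_degree [Fintype V] (h : H.IsH1With a S R U W) (v : V) :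
    3 * a ≤ 2 * H.degree v + 1 := by
  obtain ⟨t, ht⟩ := h.odd
  have := h.three_le
  have hS := h.card_S
  have hW := h.card_W
  have hU := h.card_U
  have hR := h.card_R
  rcases h.cover v with hv | hv | hv | hv
  · have h1 := H.degreeIn_add_degreeIn_le h.disjoint_UW v
    have h2 : 2 * U.card ≤ H.degreeIn U v :=
      two_mul_card_le_degreeIn fun u hu => h.arcs_US u hu v hv
    have h3 : W.card ≤ H.degreeIn W v := card_le_degreeIn fun w hw => h.arcs_WS w hw v hv
    omega
  · have h1 := H.degreeIn_add_degreeIn_le h.disjoint_UW v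
    have h2 := h.degree_R v hv
    have h3 : 2 * W.card ≤ H.degreeIn W v :=
      two_mul_card_le_degreeIn fun w hw => (h.arcs_RW v hv w hw).symm
    omega
  · have h1 := H.degreeIn_add_degreeIn_le h.disjoint_SR v
    have h2 := h.degree_U v hv
    have h3 : 2 * S.card ≤ H.degreeIn S v :=
      two_mul_card_le_degreeIn fun s hs => (h.arcs_US v hv s hs).symm
    omega
  · have h1 := H.degreeIn_add_degreeIn_le h.disjoint_SR v
    have h2 : 2 * R.card ≤ H.degreeIn R v :=
      two_mul_card_le_degreeIn fun r hr => h.arcs_RW r hr v hv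
    have h3 : S.card ≤ H.degreeIn S v := by
      classical
      unfold degreeIn
      rw [Finset.filter_true_of_mem (p := fun u => H.Adj v u) fun s hs => h.arcs_WS v hv s hs]
      omega
    omega

/-- The vertices of `S` have all their out-neighbours in the smaller set `U`. -/
theorem not_isHamiltonian (h : H.IsH1With a S R U W) : ¬ H.IsHamiltonian := by
  rintro ⟨n, -, c, hc, hadj⟩
  have hle : S.card ≤ U.card := by
    obtain ⟨g, hgc, hcg⟩ := Function.bijective_iff_has_inverse.mp hc
    refine Finset.card_le_card_of_injOn (fun s => c (g s + 1)) (fun s hs => ?_) ?_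
    · have h1 := hadj (g s)
      rw [hcg] at h1
      have h2 := Finset.disjoint_left.mp h.disjoint_SR hs
      have h3 := Finset.disjoint_left.mp h.disjoint_SU hs
      have h4 := Finset.disjoint_left.mp h.disjoint_SW hs
      have := h.arcs_only _ _ h1
      simp only [h2, h3, h4, false_and, false_or, or_false] at this
      exact this.2
    · intro s _ t _ hst
      have h1 := add_right_cancel (hc.1 hst)
      rw [← hcg s, ← hcg t, h1]
  have := h.card_S
  have := h.card_U
  have := h.three_le
  obtain ⟨t, ht⟩ := h.odd
  omega

end IsH1With

theorem digraphH2_isStrong : digraphH2.IsStrong := by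
  have h : ∀ u v : Fin 3 ⊕ Fin 3, (ofMatrices
      ![![true, true, false], ![false, true, true], ![true, false, true]]
      ![![true, false, true], ![false, true, true], ![true, true, false]]).Adj u v →
      Relation.ReflTransGen digraphH2.Adj u v := fun u v h => by
    rw [digraphH2_eq_ofMatrices]; exact .single h
  have h1 := h (.inl 0) (.inr 1) rfl
  have h2 := h1.trans (h (.inr 1) (.inl 2) rfl)
  have h3 := h2.trans (h (.inl 2) (.inr 2) rfl)
  have h4 := h (.inr 2) (.inl 0) rfl
  have h5 := (h (.inl 2) (.inr 2) rfl).trans h4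
  have h6 := (h (.inr 1) (.inl 2) rfl).trans h5
  have hfrom : ∀ v, Relation.ReflTransGen digraphH2.Adj (.inl 0) v := by
    rintro (v | v) <;> fin_cases v
    exacts [.refl, h1.trans (h _ (.inl 1) rfl), h2, h _ (.inr 0) rfl, h1, h3]
  have hto : ∀ v, Relation.ReflTransGen digraphH2.Adj v (.inl 0) := by
    rintro (v | v) <;> fin_cases v
    exacts [.refl, (h (.inl 1) (.inr 1) rfl).trans h6, h5, h (.inr 0) _ rfl, h6, h4]
  exact fun x y => (hto x).trans (hfrom y)

theorem degree_digraphH2 (v : Fin 3 ⊕ Fin 3) : digraphH2.degree v = 4 := by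
  rw [digraphH2_eq_ofMatrices]
  rcases v with v | v
  · rw [degree_ofMatrices_inl]
    revert v
    decide
  · rw [degree_ofMatrices_inr]
    revert v
    decide

set_option synthInstance.maxHeartbeats 200000 in
set_option synthInstance.maxSize 2000 in
/-- A path through all the vertices that starts at `x₂` cannot be closed to a cycle. Vertices at odd
distance on the path lie on different sides, so only the other pairs need to be distinct. -/
theorem digraphH2_no_sixCycle : ∀ v₁, digraphH2.Adj (.inl 1) v₁ → ∀ v₂, digraphH2.Adj v₁ v₂ →
    v₂ ≠ .inl 1 → ∀ v₃, digraphH2.Adj v₂ v₃ → v₃ ≠ v₁ → ∀ v₄, digraphH2.Adj v₃ v₄ → v₄ ≠ .inl 1 →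
    v₄ ≠ v₂ → ∀ v₅, digraphH2.Adj v₄ v₅ → v₅ ≠ v₁ → v₅ ≠ v₃ → ¬ digraphH2.Adj v₅ (.inl 1) := by
  rw [digraphH2_eq_ofMatrices]
  decide

theorem digraphH2_not_isHamiltonian : ¬ digraphH2.IsHamiltonian := by
  rintro ⟨n, hn, c, hc, hadj⟩
  have : NeZero n := ⟨by omega⟩
  obtain rfl : n = 6 := by
    have := Fintype.card_of_bijective hc
    rwa [ZMod.card] at this
  obtain ⟨k, hk⟩ := hc.2 (.inl 1)
  have hne : ∀ k : ZMod 6, k + 1 + 1 ≠ k ∧ k + 1 + 1 + 1 + 1 ≠ k ∧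
      k + 1 + 1 + 1 + 1 + 1 + 1 = k := by
    decide
  have hne' : ∀ i j, i ≠ j → c i ≠ c j := fun i j h h' => h (hc.1 h')
  refine digraphH2_no_sixCycle (c (k + 1)) (hk ▸ hadj k) _ (hadj _) (hk ▸ hne' _ _ (hne k).1)
    _ (hadj _) (hne' _ _ (hne _).1) _ (hadj _) (hk ▸ hne' _ _ (hne k).2.1) (hne' _ _ (hne _).1)
    _ (hadj _) (hne' _ _ (hne _).2.1) (hne' _ _ (hne _).1) ?_
  have := hadj (k + 1 + 1 + 1 + 1 + 1)
  rwa [(hne k).2.2, hk] at this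

end Digraph

theorem mainTheorem1 {V : Type*} [Fintype V] (D : Digraph V) (a : ℕ) (ha : 3 ≤ a)
    (V₁ V₂ : Finset V) (hD : D.IsBalancedBipartite a V₁ V₂) :
    (D.IsStrong → D.ConditionM a (-1) →
      D.IsHamiltonian ∨ (∃ H ∈ Digraph.familyH1 V a, D.IsIsomorphic H) ∨
        D.IsIsomorphic Digraph.digraphH2) ∧
    ((∃ H ∈ Digraph.familyH1 V a, D.IsIsomorphic H) ∨ D.IsIsomorphic Digraph.digraphH2 →
      D.IsStrong ∧ D.ConditionM a (-1) ∧ ¬ D.IsHamiltonian) := by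
  classical
  have hX := hD.isBipartition
  constructor
  · intro hs hM
    rcases hX.exists_isCycleFactor_or_mem_familyH1 (hX.sideCondition hM) hs ha with ⟨σ, hσ⟩ | h
    · rcases ha.eq_or_lt with rfl | ha
      · exact (hX.isHamiltonian_or_isIsomorphic_digraphH2 hM hs hσ).imp_right Or.inr
      · exact Or.inl (hX.isHamiltonian_of_isCycleFactor (hX.sideCondition hM) hs ha hσ)
    · exact Or.inr (Or.inl ⟨D, h, ⟨RelIso.refl _⟩⟩)
  · rintro (⟨H, ⟨S, R, U, W, hH⟩, ⟨e⟩⟩ | ⟨⟨e⟩⟩)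
    · refine ⟨hH.isStrong.of_relIso e.symm, .of_relIso e.symm fun u v _ _ _ => ?_,
        fun h => hH.not_isHamiltonian (h.of_relIso e)⟩
      have := hH.le_two_mul_degree u
      have := hH.le_two_mul_degree v
      omega
    · obtain rfl : a = 3 := by
        have := Fintype.card_congr e.toEquiv
        rw [hX.card_eq] at this
        simp at this
        omega
      refine ⟨Digraph.digraphH2_isStrong.of_relIso e.symm, .of_relIso e.symm fun u v _ _ _ => ?_,
        fun h => Digraph.digraphH2_not_isHamiltonian (h.of_relIso e)⟩
      rw [Digraph.degree_digraphH2, Digraph.degree_digraphH2]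
      norm_num
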